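/- **Corollary 4.5.** Let $(M,g)$ be an $n$-dimensional smooth Riemannian manifold (without boundary) whose tangent bundle splits $g$-orthogonally as $TM=X\oplus Y$ into smooth sub-bundles of ranks $r$ and $s$. For a constant $f>0$ let $g'=g_X\oplus\frac1{f^2}g_Y$, that is, $g'=g$ on $X$, $g'=\frac1{f^2}g$ on $Y$, and $X\perp_{g'}Y$. Suppose that $Y$ is everywhere non-involutive: for every $x\in M$ there are smooth sections $U,V$ of $Y$, defined near $x$, with $[U,V]_x\notin Y_x$. (Equivalently, in a local $g$-orthonormal frame $e_1,\dots,e_n$ around $x$ with $e_1,\dots,e_r$ spanning $X$ and $e_{r+1},\dots,e_n$ spanning $Y$, some structure function $c^i_{\gamma\beta}$ with $i\le r<\gamma,\beta$, where $[e_\gamma,e_\beta]=\sum_k c^k_{\gamma\beta}e_k$, is nonzero at $x$.) Then for every compact set $K\subseteq M$ there is $f_0>0$ such that for every constant $f\ge f_0$, $g'$ is a smooth Riemannian metric on $M$ and its scalar curvature is negative at every point of $K$. In particular, if $M$ is compact, then for all sufficiently large $f$ the metric $g'$ has negative scalar curvature on all of $M$. -/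

import Mathlib

open scoped Manifold ContDiff Topology

noncomputable section

/-! ## Curvature of a matrix-valued metric on a domain of `ℝⁿ`

The functions below take the matrix `G = (g_ij)` of a Riemannian metric in coordinates, as a
function on `ℝⁿ`, to the classical quantities at a point. Only the germ of `G` at the point is
used. -/

/-- The partial derivative `∂_i F` at `y`. -/
def partialDeriv {n : ℕ} (i : Fin n) (F : EuclideanSpace ℝ (Fin n) → ℝ)
    (y : EuclideanSpace ℝ (Fin n)) : ℝ :=
  fderiv ℝ F y (EuclideanSpace.single i (1 : ℝ))

/-- The Christoffel symbol
`Γ^k_ij = ½ ∑_l g^{kl} (∂_i g_jl + ∂_j g_il - ∂_l g_ij)` of the Levi-Civita connection. -/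
def christoffel {n : ℕ} (G : EuclideanSpace ℝ (Fin n) → Matrix (Fin n) (Fin n) ℝ)
    (k i j : Fin n) (y : EuclideanSpace ℝ (Fin n)) : ℝ :=
  (1 / 2 : ℝ) * ∑ l, (G y)⁻¹ k l *
    (partialDeriv i (fun z => G z j l) y + partialDeriv j (fun z => G z i l) y
      - partialDeriv l (fun z => G z i j) y)

/-- The component `R^l_kij` of the curvature tensor, where `R(∂_i, ∂_j) ∂_k = ∑_l R^l_kij ∂_l` and
`R(U, V) W = ∇_U ∇_V W - ∇_V ∇_U W - ∇_[U,V] W`: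
`R^l_kij = ∂_i Γ^l_jk - ∂_j Γ^l_ik + ∑_m (Γ^l_im Γ^m_jk - Γ^l_jm Γ^m_ik)`. -/
def riemannCoord {n : ℕ} (G : EuclideanSpace ℝ (Fin n) → Matrix (Fin n) (Fin n) ℝ)
    (l k i j : Fin n) (y : EuclideanSpace ℝ (Fin n)) : ℝ :=
  partialDeriv i (christoffel G l j k) y - partialDeriv j (christoffel G l i k) y
    + ∑ m, (christoffel G l i m y * christoffel G m j k y
        - christoffel G l j m y * christoffel G m i k y)

/-- The Ricci curvature `Ric_kj = ∑_i R^i_kij`. -/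
def ricciCoord {n : ℕ} (G : EuclideanSpace ℝ (Fin n) → Matrix (Fin n) (Fin n) ℝ)
    (k j : Fin n) (y : EuclideanSpace ℝ (Fin n)) : ℝ :=
  ∑ i, riemannCoord G i k i j y

/-- The scalar curvature `∑_{k,j} g^{kj} Ric_kj`. -/
def scalarCoord {n : ℕ} (G : EuclideanSpace ℝ (Fin n) → Matrix (Fin n) (Fin n) ℝ)
    (y : EuclideanSpace ℝ (Fin n)) : ℝ :=
  ∑ k, ∑ j, (G y)⁻¹ k j * ricciCoord G k j y

/-! ## Riemannian metrics and scalar curvature on a manifold -/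

/-- A smooth Riemannian metric on the `n`-dimensional manifold `M` (without boundary). -/
abbrev SmoothRiemannianMetric (n : ℕ) (M : Type*) [TopologicalSpace M]
    [ChartedSpace (EuclideanSpace ℝ (Fin n)) M] [IsManifold (𝓡 n) ∞ M] : Type _ :=
  Bundle.ContMDiffRiemannianMetric (𝓡 n) ∞ (EuclideanSpace ℝ (Fin n))
    (fun x : M => TangentSpace (𝓡 n) x)

/-- The `i`-th coordinate vector field of the preferred chart at `p`, at the point of `M` with
coordinates `y`. -/
def chartVector {n : ℕ} {M : Type*} [TopologicalSpace M]
    [ChartedSpace (EuclideanSpace ℝ (Fin n)) M] (p : M) (i : Fin n)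
    (y : EuclideanSpace ℝ (Fin n)) : TangentSpace (𝓡 n) ((extChartAt (𝓡 n) p).symm y) :=
  mfderiv 𝓘(ℝ, EuclideanSpace ℝ (Fin n)) (𝓡 n) (extChartAt (𝓡 n) p).symm y
    (EuclideanSpace.single i (1 : ℝ) : EuclideanSpace ℝ (Fin n))

/-- The matrix `g_ij = g(∂_i, ∂_j)` of the metric `g` in the preferred chart at `p`. -/
def chartMatrix {n : ℕ} {M : Type*} [TopologicalSpace M]
    [ChartedSpace (EuclideanSpace ℝ (Fin n)) M] [IsManifold (𝓡 n) ∞ M]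
    (g : SmoothRiemannianMetric n M) (p : M) (y : EuclideanSpace ℝ (Fin n)) :
    Matrix (Fin n) (Fin n) ℝ :=
  Matrix.of fun i j =>
    g.inner ((extChartAt (𝓡 n) p).symm y) (chartVector p i y) (chartVector p j y)

/-- The scalar curvature of `(M, g)` at `p`, computed in the preferred chart at `p` (the value is
the same in every chart around `p`). -/
def scalarCurvature {n : ℕ} {M : Type*} [TopologicalSpace M]
    [ChartedSpace (EuclideanSpace ℝ (Fin n)) M] [IsManifold (𝓡 n) ∞ M]
    (g : SmoothRiemannianMetric n M) (p : M) : ℝ :=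
  scalarCoord (chartMatrix g p) (extChartAt (𝓡 n) p p)

/-! ## Distributions -/

/-- The vector field `U` is smooth on the set `O`. -/
def SmoothFieldOn {n : ℕ} {M : Type*} [TopologicalSpace M]
    [ChartedSpace (EuclideanSpace ℝ (Fin n)) M] [IsManifold (𝓡 n) ∞ M]
    (U : ∀ x : M, TangentSpace (𝓡 n) x) (O : Set M) : Prop :=
  ContMDiffOn (𝓡 n) (𝓡 n).tangent ∞
    (fun x => (⟨x, U x⟩ : TangentBundle (𝓡 n) M)) O

/-- The family `Y` of subspaces of the tangent spaces is a smooth sub-bundle (distribution) of rank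
`s`: around every point it has a smooth local frame of `s` vector fields. -/
def IsSmoothSubbundle {n : ℕ} {M : Type*} [TopologicalSpace M]
    [ChartedSpace (EuclideanSpace ℝ (Fin n)) M] [IsManifold (𝓡 n) ∞ M]
    (s : ℕ) (Y : ∀ x : M, Submodule ℝ (TangentSpace (𝓡 n) x)) : Prop :=
  ∀ p : M, ∃ O : Set M, IsOpen O ∧ p ∈ O ∧
    ∃ e : Fin s → ∀ x : M, TangentSpace (𝓡 n) x,
      (∀ a, SmoothFieldOn (e a) O) ∧
      ∀ x ∈ O, LinearIndependent ℝ (fun a => e a x) ∧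
        Submodule.span ℝ (Set.range fun a => e a x) = Y x

/-- `TM = X ⊕ Y` is a `g`-orthogonal splitting into smooth sub-bundles of ranks `r` and `s`. -/
def IsOrthogonalSplitting {n : ℕ} {M : Type*} [TopologicalSpace M]
    [ChartedSpace (EuclideanSpace ℝ (Fin n)) M] [IsManifold (𝓡 n) ∞ M]
    (g : SmoothRiemannianMetric n M) (r s : ℕ)
    (X Y : ∀ x : M, Submodule ℝ (TangentSpace (𝓡 n) x)) : Prop :=
  IsSmoothSubbundle r X ∧ IsSmoothSubbundle s Y ∧
    ∀ x : M, IsCompl (X x) (Y x) ∧ ∀ u ∈ X x, ∀ v ∈ Y x, g.inner x u v = 0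

/-- `Y` is everywhere non-involutive: at every point `x` there are smooth local sections `U, V` of
`Y` with `[U, V]_x ∉ Y_x`. (Sections `U, V` that work for all `x` at once are a special case, and so
is a local frame of `TM` around every point, adapted to `Y`, in which some structure function
`c^i_γβ`, with `γ, β` in the directions of `Y` and `i` in a complementary one, is nonzero.) -/
def EverywhereNonInvolutive {n : ℕ} {M : Type*} [TopologicalSpace M]
    [ChartedSpace (EuclideanSpace ℝ (Fin n)) M] [IsManifold (𝓡 n) ∞ M]
    (Y : ∀ x : M, Submodule ℝ (TangentSpace (𝓡 n) x)) : Prop :=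
  ∀ x : M, ∃ O : Set M, IsOpen O ∧ x ∈ O ∧
    ∃ U V : ∀ y : M, TangentSpace (𝓡 n) y,
      SmoothFieldOn U O ∧ SmoothFieldOn V O ∧ (∀ y ∈ O, U y ∈ Y y ∧ V y ∈ Y y) ∧
      VectorField.mlieBracket (𝓡 n) U V x ∉ Y x

/-- `g' = g_X ⊕ (1 / f²) g_Y` for the constant `f`. When `TM = X ⊕ Y`, this determines `g'`. -/
def IsCollapsedMetric {n : ℕ} {M : Type*} [TopologicalSpace M]
    [ChartedSpace (EuclideanSpace ℝ (Fin n)) M] [IsManifold (𝓡 n) ∞ M]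
    (g : SmoothRiemannianMetric n M)
    (X Y : ∀ x : M, Submodule ℝ (TangentSpace (𝓡 n) x)) (f : ℝ)
    (g' : SmoothRiemannianMetric n M) : Prop :=
  ∀ x : M,
    (∀ u ∈ X x, ∀ v ∈ X x, g'.inner x u v = g.inner x u v) ∧
    (∀ u ∈ Y x, ∀ v ∈ Y x, g'.inner x u v = (1 / f ^ 2) * g.inner x u v) ∧
    (∀ u ∈ X x, ∀ v ∈ Y x, g'.inner x u v = 0)

end

/-! The proof rests on a formula for scalar curvature in an orthonormal frame e_a with structure
functions c_abd = ⟨[e_a, e_b], e_d⟩: scal = 2 Σ e_a(c_abb) - Σ_d (Σ_a c_daa)² - ½ Σ c_abd c_adb - ¼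
Σ c_abd². It is `sum_curvatureAt` on open subsets of a vector space; `scalarCoord_eq_frameScalar`
identifies its left side with the coordinate expression, and `scalarCurvature_eq_frameScalar`
carries it to the manifold.

Take a g-orthonormal frame adapted to X ⊕ Y and multiply its Y-part by f. The result is
g'-orthonormal, and c_abd acquires the factor l_a l_b / l_d, where l is 1 on X and f on Y
(`scalarCurvature_rescaled`). The derivative terms and the mixed products then scale by l_a² ≤ f².
All remaining terms are negative squares; among them those with a, b in Y and d in X scale by f⁴.
Hence scal(g') ≤ f² C - f⁴ A (`frameScalar_collapsed_le`), with C and A continuous and independent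
of f.

The Lie bracket of sections of Y is tensorial modulo Y, so non-involutivity at a point forces some
such c_abd to be nonzero there, whence A > 0
(`EverywhereNonInvolutive.exists_structureFunctionM_ne_zero`). Continuity makes the bound negative
near each point for large f, and compactness of K gives one threshold. -/

noncomputable section

/-! ## Connections on open subsets of a vector space -/

section Connection

variable {V : Type*} [NormedAddCommGroup V] [NormedSpace ℝ V]

/-- The covariant derivative `∇_U W` for the connection with Christoffel symbols `Γ`. -/
def covDeriv (Γ : V → V →L[ℝ] V →L[ℝ] V) (U W : V → V) (y : V) : V :=
  fderiv ℝ W y (U y) + Γ y (U y) (W y)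

/-- The curvature tensor of the connection with Christoffel symbols `Γ`. -/
def curvatureAt (Γ : V → V →L[ℝ] V →L[ℝ] V) (y u v w : V) : V :=
  fderiv ℝ Γ y u v w - fderiv ℝ Γ y v u w + Γ y u (Γ y v w) - Γ y v (Γ y u w)

lemma fderiv_covDeriv {Γ : V → V →L[ℝ] V →L[ℝ] V} {U W : V → V} {y : V}
    (hΓ : DifferentiableAt ℝ Γ y) (hU : DifferentiableAt ℝ U y) (hW : ContDiffAt ℝ 2 W y)
    (u : V) :
    fderiv ℝ (covDeriv Γ U W) y u =
      fderiv ℝ (fderiv ℝ W) y u (U y) + fderiv ℝ W y (fderiv ℝ U y u)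
        + fderiv ℝ Γ y u (U y) (W y) + Γ y (fderiv ℝ U y u) (W y)
        + Γ y (U y) (fderiv ℝ W y u) := by
  have hW1 : DifferentiableAt ℝ W y := hW.differentiableAt (by norm_num)
  have hW2 : DifferentiableAt ℝ (fderiv ℝ W) y :=
    (hW.fderiv_right (m := 1) (by norm_num)).differentiableAt (by norm_num)
  have h1 := hW2.hasFDerivAt.clm_apply hU.hasFDerivAt
  have h2 := (hΓ.hasFDerivAt.clm_apply hU.hasFDerivAt).clm_apply hW1.hasFDerivAt
  have h3 := (h1.add h2).fderiv
  have h4 : covDeriv Γ U W = (fun y => fderiv ℝ W y (U y)) + (fun y => Γ y (U y) (W y)) := rfl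
  rw [h4, h3]
  simp
  abel

/-- Second derivatives of `W` cancel by symmetry, and the derivatives of `U₁` and `U₂` assemble into
the bracket term, so the pointwise tensor `curvatureAt` can be computed with non-constant frame
fields. -/
lemma covDeriv_commutator {Γ : V → V →L[ℝ] V →L[ℝ] V} {U₁ U₂ W : V → V} {y : V}
    (hΓ : DifferentiableAt ℝ Γ y) (h₁ : DifferentiableAt ℝ U₁ y)
    (h₂ : DifferentiableAt ℝ U₂ y) (hW : ContDiffAt ℝ 2 W y) :
    curvatureAt Γ y (U₁ y) (U₂ y) (W y) =
      covDeriv Γ U₁ (covDeriv Γ U₂ W) y - covDeriv Γ U₂ (covDeriv Γ U₁ W) y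
        - covDeriv Γ (VectorField.lieBracket ℝ U₁ U₂) W y := by
  have hs : fderiv ℝ (fderiv ℝ W) y (U₁ y) (U₂ y) = fderiv ℝ (fderiv ℝ W) y (U₂ y) (U₁ y) :=
    (hW.isSymmSndFDerivAt (by simp)) _ _
  have e1 : covDeriv Γ U₁ (covDeriv Γ U₂ W) y =
    fderiv ℝ (covDeriv Γ U₂ W) y (U₁ y) + Γ y (U₁ y) (covDeriv Γ U₂ W y) := rfl
  have e2 : covDeriv Γ U₂ (covDeriv Γ U₁ W) y =
    fderiv ℝ (covDeriv Γ U₁ W) y (U₂ y) + Γ y (U₂ y) (covDeriv Γ U₁ W y) := rfl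
  rw [e1, e2, fderiv_covDeriv hΓ h₂ hW, fderiv_covDeriv hΓ h₁ hW]
  simp only [covDeriv, curvatureAt, VectorField.lieBracket, map_add, map_sub, hs,
    sub_apply]
  abel

lemma covDeriv_sub_covDeriv {Γ : V → V →L[ℝ] V →L[ℝ] V} {U W : V → V} {y : V}
    (hΓ : ∀ u v, Γ y u v = Γ y v u) :
    covDeriv Γ U W y - covDeriv Γ W U y = VectorField.lieBracket ℝ U W y := by
  simp only [covDeriv, VectorField.lieBracket, hΓ (U y) (W y)]
  abel

lemma fderiv_bilin_covDeriv {B : V → V →L[ℝ] V →L[ℝ] ℝ} {Γ : V → V →L[ℝ] V →L[ℝ] V}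
    {U W Z : V → V} {y : V} (hB : DifferentiableAt ℝ B y)
    (hW : DifferentiableAt ℝ W y) (hZ : DifferentiableAt ℝ Z y)
    (hΓ : ∀ u v w, fderiv ℝ B y u v w = B y (Γ y u v) w + B y v (Γ y u w)) :
    fderiv ℝ (fun z => B z (W z) (Z z)) y (U y) =
      B y (covDeriv Γ U W y) (Z y) + B y (W y) (covDeriv Γ U Z y) := by
  have h2 := ((hB.hasFDerivAt.clm_apply hW.hasFDerivAt).clm_apply hZ.hasFDerivAt).fderiv
  rw [h2]
  simp [covDeriv, hΓ]
  ring

end Connection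

/-! ## The scalar curvature in an orthonormal frame -/

section StructureFunctions

variable {ι : Type*} [Fintype ι]

/-- The scalar curvature of a Riemannian metric, in terms of the structure functions
`c a b d = ⟨[e_a, e_b], e_d⟩` of an orthonormal frame and their derivatives
`dc a b = e_a(c a b b)`. -/
def frameScalar (c : ι → ι → ι → ℝ) (dc : ι → ι → ℝ) : ℝ :=
  2 * ∑ a, ∑ b, dc a b - ∑ d, (∑ a, c d a a) ^ 2
    - (1 / 2) * ∑ a, ∑ b, ∑ d, c a b d * c a d b - (1 / 4) * ∑ a, ∑ b, ∑ d, c a b d ^ 2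

/-- This evaluates the part of the curvature quadratic in the connection coefficients `w`, which the
Koszul formula expresses through `c`. Antisymmetry reduces every product to squares and products of
cyclically permuted copies of `c a b d`; cyclic relabelling of the sums then collects them. -/
lemma sum_koszul_quadratic (c w : ι → ι → ι → ℝ) (hc : ∀ a b d, c a b d = - c b a d)
    (hw : ∀ a b d, w a b d = (1 / 2) * (c a b d - c b d a + c d a b)) :
    ∑ a, ∑ b, ∑ d, (w a b d * w b a d - c a b d * w d b a) =
      - (1 / 2) * ∑ a, ∑ b, ∑ d, c a b d * c a d b
      - (1 / 4) * ∑ a, ∑ b, ∑ d, c a b d ^ 2 := by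
  have cyc : ∀ F : ι → ι → ι → ℝ, ∑ a, ∑ b, ∑ d, F b d a = ∑ a, ∑ b, ∑ d, F a b d := by
    intro F
    calc ∑ a, ∑ b, ∑ d, F b d a = ∑ b, ∑ a, ∑ d, F b d a := Finset.sum_comm
      _ = ∑ b, ∑ d, ∑ a, F b d a := Finset.sum_congr rfl fun _ _ => Finset.sum_comm
  have cyc' : ∀ F : ι → ι → ι → ℝ, ∑ a, ∑ b, ∑ d, F d a b = ∑ a, ∑ b, ∑ d, F a b d := by
    intro F
    rw [← cyc F, ← cyc (fun a b d => F b d a)]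
  have hterm : ∀ a b d, w a b d * w b a d - c a b d * w d b a =
      (1 / 4) * c d a b ^ 2 + (1 / 4) * c b d a ^ 2 - (3 / 4) * c a b d ^ 2
      - (1 / 2) * (c b d a * c d a b) + (1 / 2) * (c a b d * c b d a)
      + (1 / 2) * (c d a b * c a b d) := by
    intro a b d
    rw [hw a b d, hw b a d, hw d b a, hc b a d, hc a d b, hc d b a]
    ring
  have hQ : ∀ a b d, c a b d * c a d b = - (c d a b * c a b d) := by
    intro a b d
    rw [hc a d b]
    ring
  simp only [hterm, hQ, Finset.sum_add_distrib, Finset.sum_sub_distrib, Finset.sum_neg_distrib,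
    ← Finset.mul_sum]
  have h1 := cyc (fun a b d => c a b d ^ 2)
  have h2 := cyc' (fun a b d => c a b d ^ 2)
  have h3 := cyc (fun a b d => c a b d * c b d a)
  have h4 := cyc' (fun a b d => c a b d * c b d a)
  rw [h1, h2, h3, h4]
  ring

end StructureFunctions

section FrameFormula

variable {V : Type*} [NormedAddCommGroup V] [NormedSpace ℝ V] {ι : Type*}

/-- `e` is a smooth orthonormal frame of the smooth metric `B` on the set `O`, and `Γ` are the
Christoffel symbols of the Levi-Civita connection of `B` on `O`. -/
structure IsLeviCivitaFrame [Fintype ι] [DecidableEq ι] (O : Set V) (B : V → V →L[ℝ] V →L[ℝ] ℝ)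
    (Γ : V → V →L[ℝ] V →L[ℝ] V) (e : ι → V → V) : Prop where
  isOpen : IsOpen O
  smooth_metric : ContDiffOn ℝ ∞ B O
  smooth_connection : ContDiffOn ℝ ∞ Γ O
  smooth_frame : ∀ a, ContDiffOn ℝ ∞ (e a) O
  metric_symm : ∀ y ∈ O, ∀ u v, B y u v = B y v u
  torsion_free : ∀ y ∈ O, ∀ u v, Γ y u v = Γ y v u
  metric_compatible : ∀ y ∈ O, ∀ u v w,
    fderiv ℝ B y u v w = B y (Γ y u v) w + B y v (Γ y u w)
  orthonormal : ∀ y ∈ O, ∀ a b, B y (e a y) (e b y) = if a = b then 1 else 0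
  spanning : ∀ y ∈ O, ∀ v, v = ∑ a, B y v (e a y) • e a y

/-- The structure functions `⟨[e_a, e_b], e_d⟩` of a frame. -/
def structureFunction (B : V → V →L[ℝ] V →L[ℝ] ℝ) (e : ι → V → V) (a b d : ι) (y : V) : ℝ :=
  B y (VectorField.lieBracket ℝ (e a) (e b) y) (e d y)

variable {O : Set V} {B : V → V →L[ℝ] V →L[ℝ] ℝ} {Γ : V → V →L[ℝ] V →L[ℝ] V} {e : ι → V → V}

lemma structureFunction_swap (y : V) (a b d : ι) :
    structureFunction B e a b d y = - structureFunction B e b a d y := by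
  simp only [structureFunction]
  rw [VectorField.lieBracket_swap]
  simp

namespace IsLeviCivitaFrame

variable [Fintype ι] [DecidableEq ι]

lemma bilin_eq_sum (h : IsLeviCivitaFrame O B Γ e) {y : V} (hy : y ∈ O) (u v : V) :
    B y u v = ∑ d, B y u (e d y) * B y v (e d y) := by
  conv_lhs => rw [h.spanning y hy v]
  simp [mul_comm]

lemma differentiableAt_metric (h : IsLeviCivitaFrame O B Γ e) {y : V} (hy : y ∈ O) :
    DifferentiableAt ℝ B y :=
  (h.smooth_metric.contDiffAt (h.isOpen.mem_nhds hy)).differentiableAt (by simp)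

lemma differentiableAt_connection (h : IsLeviCivitaFrame O B Γ e) {y : V} (hy : y ∈ O) :
    DifferentiableAt ℝ Γ y :=
  (h.smooth_connection.contDiffAt (h.isOpen.mem_nhds hy)).differentiableAt (by simp)

lemma differentiableAt_frame (h : IsLeviCivitaFrame O B Γ e) {y : V} (hy : y ∈ O) (a : ι) :
    DifferentiableAt ℝ (e a) y :=
  ((h.smooth_frame a).contDiffAt (h.isOpen.mem_nhds hy)).differentiableAt (by simp)

lemma smooth_covDeriv (h : IsLeviCivitaFrame O B Γ e) (a b : ι) :
    ContDiffOn ℝ ∞ (covDeriv Γ (e a) (e b)) O :=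
  (((h.smooth_frame b).fderiv_of_isOpen h.isOpen (m := ∞) (by simp)).clm_apply
    (h.smooth_frame a)).add
    ((h.smooth_connection.clm_apply (h.smooth_frame a)).clm_apply (h.smooth_frame b))

lemma differentiableAt_covDeriv (h : IsLeviCivitaFrame O B Γ e) {y : V} (hy : y ∈ O) (a b : ι) :
    DifferentiableAt ℝ (covDeriv Γ (e a) (e b)) y :=
  ((h.smooth_covDeriv a b).contDiffAt (h.isOpen.mem_nhds hy)).differentiableAt (by simp)

/-- The connection coefficients `⟨∇_a e_b, e_d⟩` are antisymmetric in `b` and `d`. -/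
lemma coeff_antisymm (h : IsLeviCivitaFrame O B Γ e) {y : V} (hy : y ∈ O) (a b d : ι) :
    B y (covDeriv Γ (e a) (e b) y) (e d y) = - B y (covDeriv Γ (e a) (e d) y) (e b y) := by
  have h1 := fderiv_bilin_covDeriv (U := e a) (h.differentiableAt_metric hy)
    (h.differentiableAt_frame hy b) (h.differentiableAt_frame hy d) (h.metric_compatible y hy)
  have h2 : (fun z => B z (e b z) (e d z)) =ᶠ[𝓝 y] fun _ => if b = d then (1 : ℝ) else 0 := by
    filter_upwards [h.isOpen.mem_nhds hy] with z hz using h.orthonormal z hz b d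
  rw [h2.fderiv_eq] at h1
  rw [h.metric_symm y hy (covDeriv Γ (e a) (e d) y)]
  simp at h1
  linarith

lemma coeff_sub_coeff (h : IsLeviCivitaFrame O B Γ e) {y : V} (hy : y ∈ O) (a b d : ι) :
    B y (covDeriv Γ (e a) (e b) y) (e d y) - B y (covDeriv Γ (e b) (e a) y) (e d y) =
      structureFunction B e a b d y := by
  rw [structureFunction, ← covDeriv_sub_covDeriv (h.torsion_free y hy)]
  simp

/-- The Koszul formula in an orthonormal frame. -/
lemma coeff_eq (h : IsLeviCivitaFrame O B Γ e) {y : V} (hy : y ∈ O) (a b d : ι) :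
    B y (covDeriv Γ (e a) (e b) y) (e d y) = (1 / 2) * (structureFunction B e a b d y
      - structureFunction B e b d a y + structureFunction B e d a b y) := by
  rw [← h.coeff_sub_coeff hy a b d, ← h.coeff_sub_coeff hy b d a, ← h.coeff_sub_coeff hy d a b]
  have h1 := h.coeff_antisymm hy a b d
  have h2 := h.coeff_antisymm hy b a d
  have h3 := h.coeff_antisymm hy d a b
  linarith

/-- Metric compatibility trades the outer covariant derivative for the derivative of a scalar
coefficient. That coefficient must be known as a function `q` on all of `O`, since it is
differentiated. -/
lemma bilin_covDeriv_covDeriv (h : IsLeviCivitaFrame O B Γ e) {y : V} (hy : y ∈ O)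
    (a b d : ι) {q : V → ℝ} (hq : ∀ z ∈ O, B z (covDeriv Γ (e b) (e d) z) (e a z) = q z) (i : ι) :
    B y (covDeriv Γ (e i) (covDeriv Γ (e b) (e d)) y) (e a y) =
      fderiv ℝ q y (e i y)
        - ∑ k, B y (covDeriv Γ (e b) (e d) y) (e k y) * B y (covDeriv Γ (e i) (e a) y) (e k y) := by
  have h1 := fderiv_bilin_covDeriv (U := e i) (h.differentiableAt_metric hy)
    (h.differentiableAt_covDeriv hy b d) (h.differentiableAt_frame hy a)
    (h.metric_compatible y hy)
  have h2 : (fun z => B z (covDeriv Γ (e b) (e d) z) (e a z)) =ᶠ[𝓝 y] q := by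
    filter_upwards [h.isOpen.mem_nhds hy] with z hz using hq z hz
  rw [h2.fderiv_eq] at h1
  rw [h1, ← h.bilin_eq_sum hy]
  ring

/-- The scalar curvature in terms of the structure functions of an orthonormal frame. -/
lemma sum_curvatureAt (h : IsLeviCivitaFrame O B Γ e) {y : V} (hy : y ∈ O) :
    ∑ a, ∑ b, B y (curvatureAt Γ y (e a y) (e b y) (e b y)) (e a y) =
      frameScalar (fun a b d => structureFunction B e a b d y)
        (fun a b => fderiv ℝ (structureFunction B e a b b) y (e a y)) := by
  set c := fun a b d => structureFunction B e a b d y with hc_def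
  set w := fun a b d => B y (covDeriv Γ (e a) (e b) y) (e d y) with hw_def
  have hc : ∀ a b d, c a b d = - c b a d := fun a b d => structureFunction_swap y a b d
  have hw : ∀ a b d, w a b d = (1 / 2) * (c a b d - c b d a + c d a b) :=
    fun a b d => h.coeff_eq hy a b d
  have hc0 : ∀ a d, c a a d = 0 := fun a d => by have := hc a a d; linarith
  -- With a repeated index the Koszul formula collapses to a single structure function, so only
  -- derivatives of the form e_a(c_abb) occur in the final formula.
  have hq1 : ∀ a b, ∀ z ∈ O, B z (covDeriv Γ (e b) (e b) z) (e a z) =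
      structureFunction B e a b b z := by
    intro a b z hz
    rw [h.coeff_eq hz, structureFunction_swap z b a b]
    have := structureFunction_swap (B := B) (e := e) z b b a
    linarith
  have hq2 : ∀ a b, ∀ z ∈ O, B z (covDeriv Γ (e a) (e b) z) (e a z) =
      - structureFunction B e b a a z := by
    intro a b z hz
    rw [h.coeff_eq hz, structureFunction_swap z a b a]
    have := structureFunction_swap (B := B) (e := e) z a a b
    linarith
  have hlie : ∀ a b, B y (covDeriv Γ (VectorField.lieBracket ℝ (e a) (e b)) (e b) y) (e a y) =
      ∑ d, c a b d * w d b a := by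
    intro a b
    have hs := h.spanning y hy (VectorField.lieBracket ℝ (e a) (e b) y)
    have : covDeriv Γ (VectorField.lieBracket ℝ (e a) (e b)) (e b) y =
        ∑ d, c a b d • covDeriv Γ (e d) (e b) y := by
      simp only [covDeriv]
      rw [hs]
      simp [hc_def, structureFunction, Finset.sum_add_distrib, smul_add]
    rw [this]
    simp [hw_def]
  have hterm : ∀ a b, B y (curvatureAt Γ y (e a y) (e b y) (e b y)) (e a y) =
      fderiv ℝ (structureFunction B e a b b) y (e a y)
        + fderiv ℝ (structureFunction B e b a a) y (e b y)
        - ∑ d, c d b b * c d a a + ∑ d, (w a b d * w b a d - c a b d * w d b a) := by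
    intro a b
    rw [covDeriv_commutator (h.differentiableAt_connection hy) (h.differentiableAt_frame hy a)
      (h.differentiableAt_frame hy b)
      (((h.smooth_frame b).contDiffAt (h.isOpen.mem_nhds hy)).of_le ENat.LEInfty.out)]
    simp only [map_sub, sub_apply]
    rw [h.bilin_covDeriv_covDeriv hy a b b (hq1 a b) a,
      h.bilin_covDeriv_covDeriv hy a a b (hq2 a b) b, hlie, Finset.sum_sub_distrib]
    have e1 : ∀ d, B y (covDeriv Γ (e b) (e b) y) (e d y) = c d b b := fun d => hq1 d b y hy
    have e2 : ∀ d, B y (covDeriv Γ (e a) (e a) y) (e d y) = c d a a := fun d => hq1 d a y hy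
    simp only [e1, e2]
    rw [show fderiv ℝ (fun z => - structureFunction B e b a a z) y =
      - fderiv ℝ (structureFunction B e b a a) y from fderiv_fun_neg]
    simp only [neg_apply, hw_def]
    ring
  simp only [hterm, Finset.sum_add_distrib, Finset.sum_sub_distrib]
  have hquad := sum_koszul_quadratic c w hc hw
  simp only [Finset.sum_sub_distrib] at hquad
  have hsq : ∑ a, ∑ b, ∑ d, c d b b * c d a a = ∑ d, (∑ a, c d a a) ^ 2 := by
    calc ∑ a, ∑ b, ∑ d, c d b b * c d a a = ∑ a, ∑ d, ∑ b, c d b b * c d a a :=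
          Finset.sum_congr rfl fun _ _ => Finset.sum_comm
      _ = ∑ d, ∑ a, ∑ b, c d b b * c d a a := Finset.sum_comm
      _ = _ := by
        refine Finset.sum_congr rfl fun d _ => ?_
        rw [sq, Finset.sum_mul_sum, Finset.sum_comm]
  have hsw : ∑ a, ∑ b, fderiv ℝ (structureFunction B e b a a) y (e b y) =
      ∑ a, ∑ b, fderiv ℝ (structureFunction B e a b b) y (e a y) := Finset.sum_comm
  rw [hsq, hsw, hquad, frameScalar]
  ring

end IsLeviCivitaFrame

end FrameFormula

/-! ## The Levi-Civita connection of a metric with an orthonormal frame -/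

section LeviCivita

variable {V : Type*} [NormedAddCommGroup V] [NormedSpace ℝ V] [FiniteDimensional ℝ V]
  {ι : Type*} [Fintype ι]

/-- The Koszul expression `½ (∂_u B(v, w) + ∂_v B(u, w) - ∂_w B(u, v))`. -/
def koszul (B : V → V →L[ℝ] V →L[ℝ] ℝ) (y u v w : V) : ℝ :=
  (1 / 2) * (fderiv ℝ B y u v w + fderiv ℝ B y v u w - fderiv ℝ B y w u v)

/-- The Christoffel symbols of the metric `B` with orthonormal frame `e`. -/
def leviCivita (B : V → V →L[ℝ] V →L[ℝ] ℝ) (e : ι → V → V) (y : V) : V →L[ℝ] V →L[ℝ] V :=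
  LinearMap.toContinuousBilinearMap (LinearMap.mk₂ ℝ
    (fun u v => ∑ a, koszul B y u v (e a y) • e a y)
    (fun u u' v => by
      simp only [← Finset.sum_add_distrib, ← add_smul]
      congr! 2
      simp [koszul]; ring)
    (fun c u v => by
      simp only [Finset.smul_sum, smul_smul]
      congr! 2
      simp [koszul]; ring)
    (fun u v v' => by
      simp only [← Finset.sum_add_distrib, ← add_smul]
      congr! 2
      simp [koszul]; ring)
    (fun c u v => by
      simp only [Finset.smul_sum, smul_smul]
      congr! 2
      simp [koszul]; ring))

lemma leviCivita_apply (B : V → V →L[ℝ] V →L[ℝ] ℝ) (e : ι → V → V) (y u v : V) :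
    leviCivita B e y u v = ∑ a, koszul B y u v (e a y) • e a y := rfl

omit [FiniteDimensional ℝ V] in
lemma fderiv_clm_apply_const₂ {F F' : Type*} [NormedAddCommGroup F] [NormedSpace ℝ F]
    [NormedAddCommGroup F'] [NormedSpace ℝ F'] {L : V → V →L[ℝ] V →L[ℝ] F} {y : V}
    (hL : DifferentiableAt ℝ L y) (l : F →L[ℝ] F') (u v w : V) :
    fderiv ℝ (fun z => l (L z v w)) y u = l (fderiv ℝ L y u v w) := by
  have h := (l.hasFDerivAt.comp y ((hL.hasFDerivAt.clm_apply (hasFDerivAt_const v y)).clm_apply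
    (hasFDerivAt_const w y))).fderiv
  rw [Function.comp_def] at h
  rw [h]
  simp

-- Expanding in the orthonormal frame replaces raising an index, so `leviCivita` represents the
-- Koszul expression with respect to `B`. Torsion-freeness and metric compatibility are then linear
-- identities between derivatives of `B`, using that these are symmetric in the last two arguments.
set_option maxSynthPendingDepth 4 in
lemma isLeviCivitaFrame_leviCivita [DecidableEq ι] {O : Set V} {B : V → V →L[ℝ] V →L[ℝ] ℝ}
    {e : ι → V → V} (hO : IsOpen O) (hB : ContDiffOn ℝ ∞ B O)
    (he : ∀ a, ContDiffOn ℝ ∞ (e a) O) (hsymm : ∀ y ∈ O, ∀ u v, B y u v = B y v u)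
    (horth : ∀ y ∈ O, ∀ a b, B y (e a y) (e b y) = if a = b then 1 else 0)
    (hspan : ∀ y ∈ O, ∀ v, v = ∑ a, B y v (e a y) • e a y) :
    IsLeviCivitaFrame O B (leviCivita B e) e := by
  have hDsymm : ∀ y ∈ O, ∀ u v w, fderiv ℝ B y u v w = fderiv ℝ B y u w v := by
    intro y hy u v w
    have hd : DifferentiableAt ℝ B y :=
      (hB.contDiffAt (hO.mem_nhds hy)).differentiableAt (by simp)
    have h1 : ∀ v w, fderiv ℝ (fun z => B z v w) y u = fderiv ℝ B y u v w :=
      fun v w => fderiv_clm_apply_const₂ hd (ContinuousLinearMap.id ℝ ℝ) u v w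
    have h2 : (fun z => B z v w) =ᶠ[𝓝 y] fun z => B z w v := by
      filter_upwards [hO.mem_nhds hy] with z hz using hsymm z hz v w
    rw [← h1, h2.fderiv_eq, h1]
  have hDB : ContDiffOn ℝ ∞ (fderiv ℝ B) O := hB.fderiv_of_isOpen hO (by simp)
  have key : ∀ y ∈ O, ∀ u v w, B y (leviCivita B e y u v) w = koszul B y u v w := by
    intro y hy u v w
    have h1 : koszul B y u v w = ∑ a, B y w (e a y) * koszul B y u v (e a y) := by
      conv_lhs => rw [hspan y hy w]
      simp only [koszul, map_sum, map_smul, sum_apply, smul_apply, smul_eq_mul,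
        Finset.mul_sum, ← Finset.sum_add_distrib, ← Finset.sum_sub_distrib]
      exact Finset.sum_congr rfl fun _ _ => by ring
    rw [h1, leviCivita_apply, map_sum, sum_apply]
    refine Finset.sum_congr rfl fun a _ => ?_
    rw [map_smul, smul_apply, smul_eq_mul, hsymm y hy (e a y) w, mul_comm]
  refine ⟨hO, hB, ?_, he, hsymm, ?_, ?_, horth, hspan⟩
  · rw [contDiffOn_clm_apply]
    intro u
    rw [contDiffOn_clm_apply]
    intro v
    simp only [leviCivita_apply, koszul]
    refine ContDiffOn.sum fun a _ => ContDiffOn.smul (contDiffOn_const.mul ?_) (he a)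
    have hea := he a
    fun_prop
  · intro y hy u v
    simp only [leviCivita_apply]
    refine Finset.sum_congr rfl fun a _ => ?_
    congr 1
    simp only [koszul, hDsymm y hy (e a y) u v]
    ring
  · intro y hy u v w
    rw [key y hy, hsymm y hy v, key y hy]
    simp only [koszul, hDsymm y hy u w v, hDsymm y hy v u w, hDsymm y hy w u v]
    ring

end LeviCivita

/-! ## Comparison with the coordinate expressions -/

section Coordinates

variable {n : ℕ} {ι : Type*} [Fintype ι] [DecidableEq ι]

local notation "𝔼" => EuclideanSpace ℝ (Fin n)

lemma EuclideanSpace.sum_coord_smul_single (v : 𝔼) :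
    ∑ i, v i • EuclideanSpace.single i (1 : ℝ) = v := by
  ext j
  simp [Pi.single_apply]

section Multilinear

variable {V : Type*} [NormedAddCommGroup V] [NormedSpace ℝ V] {κ : Type*}

lemma curvatureAt_sum_left (Γ : V → V →L[ℝ] V →L[ℝ] V) (y v w : V) (s : Finset κ) (x : κ → ℝ)
    (u : κ → V) : curvatureAt Γ y (∑ i ∈ s, x i • u i) v w =
      ∑ i ∈ s, x i • curvatureAt Γ y (u i) v w := by
  simp [curvatureAt, Finset.sum_add_distrib, smul_add, smul_sub]

lemma curvatureAt_sum_middle (Γ : V → V →L[ℝ] V →L[ℝ] V) (y u w : V) (s : Finset κ) (x : κ → ℝ)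
    (v : κ → V) : curvatureAt Γ y u (∑ i ∈ s, x i • v i) w =
      ∑ i ∈ s, x i • curvatureAt Γ y u (v i) w := by
  simp [curvatureAt, Finset.sum_add_distrib, smul_add, smul_sub]

lemma curvatureAt_sum_right (Γ : V → V →L[ℝ] V →L[ℝ] V) (y u v : V) (s : Finset κ) (x : κ → ℝ)
    (w : κ → V) : curvatureAt Γ y u v (∑ i ∈ s, x i • w i) =
      ∑ i ∈ s, x i • curvatureAt Γ y u v (w i) := by
  simp [curvatureAt, Finset.sum_add_distrib, smul_add, smul_sub]

end Multilinear

omit [DecidableEq ι] in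
lemma sum_contraction {κ : Type*} [Fintype κ] (x : ι → κ → ℝ) (R : κ → κ → κ → ℝ) :
    ∑ k, ∑ j, (∑ b, x b k * x b j) * ∑ i, R i j k =
      ∑ b, ∑ i, ∑ k, ∑ j, x b k * x b j * R i j k := by
  calc _ = ∑ k, ∑ j, ∑ b, ∑ i, x b k * x b j * R i j k := by
        simp only [Finset.sum_mul_sum]
    _ = ∑ k, ∑ b, ∑ i, ∑ j, x b k * x b j * R i j k := by
        refine Finset.sum_congr rfl fun k _ => ?_
        rw [Finset.sum_comm]
        exact Finset.sum_congr rfl fun b _ => Finset.sum_comm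
    _ = _ := by
        rw [Finset.sum_comm]
        exact Finset.sum_congr rfl fun b _ => Finset.sum_comm

/-- Scalar curvature is a double contraction of the curvature tensor, and both contractions are
independent of the basis used. The orthonormal frame need not be a coordinate frame: it enters
through the inverse metric and through a trace. -/
lemma scalarCoord_eq_frameScalar {O : Set 𝔼} {B : 𝔼 → 𝔼 →L[ℝ] 𝔼 →L[ℝ] ℝ} {e : ι → 𝔼 → 𝔼}
    {G : 𝔼 → Matrix (Fin n) (Fin n) ℝ} (hO : IsOpen O) (hB : ContDiffOn ℝ ∞ B O)
    (he : ∀ a, ContDiffOn ℝ ∞ (e a) O) (hsymm : ∀ y ∈ O, ∀ u v, B y u v = B y v u)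
    (horth : ∀ y ∈ O, ∀ a b, B y (e a y) (e b y) = if a = b then 1 else 0)
    (hspan : ∀ y ∈ O, ∀ v, v = ∑ a, B y v (e a y) • e a y)
    (hG : ∀ y ∈ O, ∀ i j, G y i j =
      B y (EuclideanSpace.single i (1 : ℝ)) (EuclideanSpace.single j (1 : ℝ)))
    {y : 𝔼} (hy : y ∈ O) :
    scalarCoord G y = frameScalar (fun a b d => structureFunction B e a b d y)
        (fun a b => fderiv ℝ (structureFunction B e a b b) y (e a y)) := by
  have hLC := isLeviCivitaFrame_leviCivita hO hB he hsymm horth hspan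
  set Γ := leviCivita B e with hΓ
  rw [← hLC.sum_curvatureAt hy]
  -- The inverse metric is Σ_a e_a ⊗ e_a; this is the expansion of the coordinate vectors in the
  -- frame, read in components.
  have hinv : ∀ z ∈ O, ∀ k l, (G z)⁻¹ k l = ∑ a, e a z k * e a z l := by
    intro z hz
    have h1 : (G z)⁻¹ = Matrix.of fun k l => ∑ a, e a z k * e a z l := by
      apply Matrix.inv_eq_right_inv
      ext k m
      have h2 := congrArg (fun v : 𝔼 => v m)
        (hspan z hz (EuclideanSpace.single k (1 : ℝ)))
      have h3 : ∀ a, B z (EuclideanSpace.single k (1 : ℝ)) (e a z) =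
          ∑ l, e a z l * G z k l := by
        intro a
        conv_lhs => rw [← EuclideanSpace.sum_coord_smul_single (e a z)]
        simp [hG z hz]
      simp only [h3] at h2
      simp only [Matrix.mul_apply, Matrix.of_apply, Matrix.one_apply]
      have h4 : (EuclideanSpace.single k (1 : ℝ) : 𝔼) m = if k = m then 1 else 0 := by
        simp [eq_comm]
      rw [← h4, h2]
      simp only [Finset.mul_sum, WithLp.ofLp_sum, WithLp.ofLp_smul, Finset.sum_apply,
        Pi.smul_apply, smul_eq_mul, Finset.sum_mul]
      rw [Finset.sum_comm]
      exact Finset.sum_congr rfl fun _ _ => Finset.sum_congr rfl fun _ _ => by ring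
    intro k l
    rw [h1]; rfl
  have hpd : ∀ z ∈ O, ∀ i j l, partialDeriv i (fun x => G x j l) z =
      fderiv ℝ B z (EuclideanSpace.single i (1 : ℝ)) (EuclideanSpace.single j (1 : ℝ))
        (EuclideanSpace.single l (1 : ℝ)) := by
    intro z hz i j l
    have h2 : (fun x => G x j l) =ᶠ[𝓝 z] fun x =>
        B x (EuclideanSpace.single j (1 : ℝ)) (EuclideanSpace.single l (1 : ℝ)) := by
      filter_upwards [hO.mem_nhds hz] with x hx using hG x hx j l
    rw [partialDeriv, h2.fderiv_eq]
    exact fderiv_clm_apply_const₂ (hLC.differentiableAt_metric hz)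
      (ContinuousLinearMap.id ℝ ℝ) _ _ _
  have hchr : ∀ z ∈ O, ∀ k i j, christoffel G k i j z =
      Γ z (EuclideanSpace.single i (1 : ℝ)) (EuclideanSpace.single j (1 : ℝ)) k := by
    intro z hz k i j
    have h3 : ∀ a, koszul B z (EuclideanSpace.single i (1 : ℝ)) (EuclideanSpace.single j (1 : ℝ))
        (e a z) = ∑ l, e a z l * koszul B z (EuclideanSpace.single i (1 : ℝ))
          (EuclideanSpace.single j (1 : ℝ)) (EuclideanSpace.single l (1 : ℝ)) := by
      intro a
      conv_lhs => rw [← EuclideanSpace.sum_coord_smul_single (e a z)]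
      simp only [koszul, map_sum, map_smul, sum_apply, smul_apply, smul_eq_mul,
        Finset.mul_sum, ← Finset.sum_add_distrib, ← Finset.sum_sub_distrib]
      exact Finset.sum_congr rfl fun _ _ => by ring
    rw [hΓ, leviCivita_apply]
    simp only [WithLp.ofLp_sum, WithLp.ofLp_smul, Finset.sum_apply, Pi.smul_apply, smul_eq_mul,
      h3]
    simp only [Finset.sum_mul, christoffel, hinv z hz, hpd z hz, Finset.mul_sum, koszul]
    rw [Finset.sum_comm]
    exact Finset.sum_congr rfl fun _ _ => Finset.sum_congr rfl fun _ _ => by ring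
  have hpdchr : ∀ i l j k, partialDeriv i (christoffel G l j k) y =
      fderiv ℝ Γ y (EuclideanSpace.single i (1 : ℝ)) (EuclideanSpace.single j (1 : ℝ))
        (EuclideanSpace.single k (1 : ℝ)) l := by
    intro i l j k
    have h2 : christoffel G l j k =ᶠ[𝓝 y] fun x => EuclideanSpace.proj (𝕜 := ℝ) l
        (Γ x (EuclideanSpace.single j (1 : ℝ)) (EuclideanSpace.single k (1 : ℝ))) := by
      filter_upwards [hO.mem_nhds hy] with x hx using hchr x hx l j k
    rw [partialDeriv, h2.fderiv_eq]
    exact fderiv_clm_apply_const₂ (hLC.differentiableAt_connection hy)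
      (EuclideanSpace.proj (𝕜 := ℝ) l) _ _ _
  have hcomp : ∀ (v w : 𝔼) (l : Fin n), Γ y v w l = ∑ m, w m *
      Γ y v (EuclideanSpace.single m (1 : ℝ)) l := by
    intro v w l
    conv_lhs => rw [← EuclideanSpace.sum_coord_smul_single w]
    simp
  have hriem : ∀ l k i j, riemannCoord G l k i j y =
      curvatureAt Γ y (EuclideanSpace.single i (1 : ℝ)) (EuclideanSpace.single j (1 : ℝ))
        (EuclideanSpace.single k (1 : ℝ)) l := by
    intro l k i j
    simp only [riemannCoord, curvatureAt, hpdchr, hchr y hy, PiLp.add_apply, PiLp.sub_apply]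
    rw [hcomp _ (Γ y (EuclideanSpace.single j (1 : ℝ)) _),
      hcomp _ (Γ y (EuclideanSpace.single i (1 : ℝ)) (EuclideanSpace.single k (1 : ℝ))),
      Finset.sum_sub_distrib]
    simp only [mul_comm]
    ring
  -- The trace of the endomorphism u ↦ R(u, v)w, taken in the coordinate basis and in the
  -- orthonormal frame.
  have htrace : ∀ v w, ∑ i, curvatureAt Γ y (EuclideanSpace.single i (1 : ℝ)) v w i =
      ∑ a, B y (curvatureAt Γ y (e a y) v w) (e a y) := by
    intro v w
    have h1 : ∀ i, curvatureAt Γ y (EuclideanSpace.single i (1 : ℝ)) v w i =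
        ∑ a, B y (EuclideanSpace.single i (1 : ℝ)) (e a y) * curvatureAt Γ y (e a y) v w i := by
      intro i
      conv_lhs => rw [hspan y hy (EuclideanSpace.single i (1 : ℝ)), curvatureAt_sum_left]
      simp
    simp only [h1]
    rw [Finset.sum_comm]
    refine Finset.sum_congr rfl fun a _ => ?_
    conv_rhs => rw [← EuclideanSpace.sum_coord_smul_single (curvatureAt Γ y (e a y) v w)]
    simp [mul_comm]
  have hexp : ∀ (b : ι) (u : 𝔼) (i : Fin n), curvatureAt Γ y u (e b y) (e b y) i =
      ∑ k, ∑ j, e b y k * e b y j * curvatureAt Γ y u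
        (EuclideanSpace.single j (1 : ℝ)) (EuclideanSpace.single k (1 : ℝ)) i := by
    intro b u i
    conv_lhs =>
      arg 1
      rw [← EuclideanSpace.sum_coord_smul_single (e b y), curvatureAt_sum_right]
    simp only [EuclideanSpace.sum_coord_smul_single, WithLp.ofLp_sum, WithLp.ofLp_smul,
      Finset.sum_apply, Pi.smul_apply, smul_eq_mul]
    refine Finset.sum_congr rfl fun k _ => ?_
    conv_lhs =>
      rw [← EuclideanSpace.sum_coord_smul_single (e b y), curvatureAt_sum_middle]
    simp only [EuclideanSpace.sum_coord_smul_single, WithLp.ofLp_sum, WithLp.ofLp_smul,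
      Finset.sum_apply, Pi.smul_apply, smul_eq_mul, Finset.mul_sum, mul_assoc]
  rw [Finset.sum_comm]
  simp only [← htrace, scalarCoord, ricciCoord, hriem, hinv y hy, hexp]
  exact sum_contraction (fun b k => e b y k) fun i j k => curvatureAt Γ y
    (EuclideanSpace.single i (1 : ℝ)) (EuclideanSpace.single j (1 : ℝ))
    (EuclideanSpace.single k (1 : ℝ)) i

end Coordinates

lemma mlieBracket_vectorSpace {F : Type*} [NormedAddCommGroup F] [NormedSpace ℝ F]
    (U W : F → F) : VectorField.mlieBracket 𝓘(ℝ, F) U W = VectorField.lieBracket ℝ U W :=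
  (VectorField.mlieBracketWithin_eq_lieBracketWithin (V := U) (W := W) (s := Set.univ)).trans
    VectorField.lieBracketWithin_univ

/-! ## Smooth vector fields and orthonormal frames on a manifold -/

section ManifoldFrames

variable {n : ℕ} {M : Type*} [TopologicalSpace M] [ChartedSpace (EuclideanSpace ℝ (Fin n)) M]
  [IsManifold (𝓡 n) ∞ M] {O : Set M}

local notation "𝔼" => EuclideanSpace ℝ (Fin n)

lemma SmoothFieldOn.inner (g : SmoothRiemannianMetric n M) {U W : ∀ x : M, TangentSpace (𝓡 n) x}
    (hU : SmoothFieldOn U O) (hW : SmoothFieldOn W O) :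
    ContMDiffOn (𝓡 n) 𝓘(ℝ, ℝ) ∞ (fun x => g.inner x (U x) (W x)) O := by
  intro x hx
  have : ContMDiffWithinAt (𝓡 n) ((𝓡 n).prod 𝓘(ℝ)) ∞
      (fun m => Bundle.TotalSpace.mk' ℝ (E := Bundle.Trivial M ℝ) m (g.inner m (U m) (W m)))
      O x := by
    apply ContMDiffWithinAt.clm_bundle_apply₂ (F₁ := 𝔼) (F₂ := 𝔼)
    · exact g.contMDiff.contMDiffAt.contMDiffWithinAt
    · exact hU x hx
    · exact hW x hx
  simp only [Bundle.contMDiffWithinAt_totalSpace] at this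
  exact this.2

lemma SmoothFieldOn.mdifferentiableAt {U : ∀ x : M, TangentSpace (𝓡 n) x}
    (hU : SmoothFieldOn U O) (hO : IsOpen O) {x : M} (hx : x ∈ O) :
    MDifferentiableAt (𝓡 n) (𝓡 n).tangent
      (fun x => (⟨x, U x⟩ : TangentBundle (𝓡 n) M)) x :=
  (hU.contMDiffAt (hO.mem_nhds hx)).mdifferentiableAt (by simp)

lemma SmoothFieldOn.mono {U : ∀ x : M, TangentSpace (𝓡 n) x} {O' : Set M}
    (hU : SmoothFieldOn U O) (h : O' ⊆ O) : SmoothFieldOn U O' := ContMDiffOn.mono hU h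

omit [IsManifold (𝓡 n) ∞ M] in
lemma isManifold_minSmoothness [h : IsManifold (𝓡 n) ∞ M] :
    IsManifold (𝓡 n) (minSmoothness ℝ 2) M :=
  .of_le (n := ∞) (by simpa using ENat.LEInfty.out)

lemma SmoothFieldOn.mlieBracket {U W : ∀ x : M, TangentSpace (𝓡 n) x} (hO : IsOpen O)
    (hU : SmoothFieldOn U O) (hW : SmoothFieldOn W O) :
    SmoothFieldOn (VectorField.mlieBracket (𝓡 n) U W) O := by
  intro x hx
  have : IsManifold (𝓡 n) (minSmoothness ℝ 2) M := isManifold_minSmoothness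
  have : IsManifold (𝓡 n) (minSmoothness ℝ 3) M :=
    .of_le (n := ∞) (by simpa using ENat.LEInfty.out)
  have : IsManifold (𝓡 n) (∞ + 1) M := .of_le (n := ∞) (by simp)
  exact (ContMDiffAt.mlieBracket_vectorField (n := ⊤) (m := ⊤) (hU.contMDiffAt (hO.mem_nhds hx))
    (hW.contMDiffAt (hO.mem_nhds hx)) (by simp)).contMDiffWithinAt


variable {ι : Type*} [Fintype ι] [DecidableEq ι]

/-- `e` is a smooth `g`-orthonormal frame of the tangent bundle on the open set `O`. -/
structure IsOrthonormalFrameOn (g : SmoothRiemannianMetric n M) (O : Set M)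
    (e : ι → ∀ x : M, TangentSpace (𝓡 n) x) : Prop where
  isOpen : IsOpen O
  smooth : ∀ a, SmoothFieldOn (e a) O
  orthonormal : ∀ x ∈ O, ∀ a b, g.inner x (e a x) (e b x) = if a = b then 1 else 0
  spanning : ∀ x ∈ O, ∀ v : TangentSpace (𝓡 n) x, v = ∑ a, g.inner x v (e a x) • e a x

/-- The structure functions `g([e_a, e_b], e_d)` of a frame. -/
def structureFunctionM (g : SmoothRiemannianMetric n M) (e : ι → ∀ x : M, TangentSpace (𝓡 n) x)
    (a b d : ι) (x : M) : ℝ :=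
  g.inner x (VectorField.mlieBracket (𝓡 n) (e a) (e b) x) (e d x)

/-- The derivatives `e_a(g([e_a, e_b], e_b))` of the structure functions. -/
def structureDerivM (g : SmoothRiemannianMetric n M) (e : ι → ∀ x : M, TangentSpace (𝓡 n) x)
    (a b : ι) (x : M) : ℝ :=
  mfderiv (𝓡 n) 𝓘(ℝ, ℝ) (structureFunctionM g e a b b) x (e a x)

lemma IsOrthonormalFrameOn.smooth_structureFunctionM {g : SmoothRiemannianMetric n M}
    {e : ι → ∀ x : M, TangentSpace (𝓡 n) x} (h : IsOrthonormalFrameOn g O e) (a b d : ι) :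
    ContMDiffOn (𝓡 n) 𝓘(ℝ, ℝ) ∞ (structureFunctionM g e a b d) O :=
  SmoothFieldOn.inner g (SmoothFieldOn.mlieBracket h.isOpen (h.smooth a) (h.smooth b)) (h.smooth d)

/-- The derivative of the inverse of the preferred chart at `p`. -/
def chartSymmDeriv (p : M) (y : 𝔼) :
    𝔼 →L[ℝ] TangentSpace (𝓡 n) ((extChartAt (𝓡 n) p).symm y) :=
  mfderiv 𝓘(ℝ, 𝔼) (𝓡 n) (extChartAt (𝓡 n) p).symm y

/-- The metric `g` in the preferred chart at `p`, as a bilinear form. -/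
def chartForm (g : SmoothRiemannianMetric n M) (p : M) (y : 𝔼) : 𝔼 →L[ℝ] 𝔼 →L[ℝ] ℝ :=
  LinearMap.toContinuousBilinearMap (LinearMap.mk₂ ℝ
    (fun u v => g.inner ((extChartAt (𝓡 n) p).symm y) (chartSymmDeriv p y u)
      (chartSymmDeriv p y v))
    (fun u u' v => by simp only [map_add, add_apply])
    (fun c u v => by simp only [map_smul, smul_apply])
    (fun u v v' => by simp only [map_add])
    (fun c u v => by simp only [map_smul]))

lemma chartForm_apply (g : SmoothRiemannianMetric n M) (p : M) (y u v : 𝔼) :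
    chartForm g p y u v = g.inner ((extChartAt (𝓡 n) p).symm y) (chartSymmDeriv p y u)
      (chartSymmDeriv p y v) := rfl

lemma contMDiffAt_extChartAt_symm_of_mem (p : M) {y : 𝔼} (hy : y ∈ (extChartAt (𝓡 n) p).target) :
    ContMDiffAt 𝓘(ℝ, 𝔼) (𝓡 n) ∞ (extChartAt (𝓡 n) p).symm y :=
  (contMDiffOn_extChartAt_symm p).contMDiffAt ((isOpen_extChartAt_target p).mem_nhds hy)

lemma isInvertible_chartSymmDeriv (p : M) {y : 𝔼}
    (hy : y ∈ (extChartAt (𝓡 n) p).target) :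
    (chartSymmDeriv p y).IsInvertible := by
  have := isInvertible_mfderivWithin_extChartAt_symm (I := 𝓡 n) hy
  rwa [show Set.range (𝓡 n) = Set.univ from (𝓡 n).range_eq_univ, mfderivWithin_univ] at this

/-- Pushing a constant field forward by the inverse chart is the same as pulling it back by the
chart, and pullbacks of smooth fields along local diffeomorphisms are smooth. -/
lemma contMDiffAt_chartSymmDeriv (p : M) {y : 𝔼}
    (hy : y ∈ (extChartAt (𝓡 n) p).target) (u : 𝔼) :
    ContMDiffAt 𝓘(ℝ, 𝔼) (𝓡 n).tangent ∞ (fun z => (⟨(extChartAt (𝓡 n) p).symm z,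
      chartSymmDeriv p z u⟩ : TangentBundle (𝓡 n) M)) y := by
  have hx : (extChartAt (𝓡 n) p).symm y ∈ (extChartAt (𝓡 n) p).source :=
    (extChartAt (𝓡 n) p).map_target hy
  have h1 : ContMDiffAt (𝓡 n) (𝓡 n).tangent ∞ (fun x => (⟨x, VectorField.mpullback (𝓡 n)
      𝓘(ℝ, 𝔼) (extChartAt (𝓡 n) p) (fun _ => u) x⟩ : TangentBundle (𝓡 n) M))
      ((extChartAt (𝓡 n) p).symm y) := by
    refine ContMDiffAt.mpullback_vectorField_preimage (n := ∞) ?_ ?_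
      (isInvertible_mfderiv_extChartAt hx) (by simp)
    · exact contMDiffAt_vectorSpace_iff_contDiffAt.2 contDiffAt_const
    · exact contMDiffAt_extChartAt' (by simpa using hx)
  refine (ContMDiffAt.comp y h1 (contMDiffAt_extChartAt_symm_of_mem p hy)).congr_of_eventuallyEq ?_
  filter_upwards [(isOpen_extChartAt_target p).mem_nhds hy] with z hz
  have hz' : (extChartAt (𝓡 n) p).symm z ∈ (extChartAt (𝓡 n) p).source :=
    (extChartAt (𝓡 n) p).map_target hz
  have h2 := mfderiv_extChartAt_comp_mfderivWithin_extChartAt_symm (I := 𝓡 n) hz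
  rw [show Set.range (𝓡 n) = Set.univ from (𝓡 n).range_eq_univ, mfderivWithin_univ] at h2
  have h3 : chartSymmDeriv p z u = VectorField.mpullback (𝓡 n) 𝓘(ℝ, 𝔼) (extChartAt (𝓡 n) p)
      (fun _ => u) ((extChartAt (𝓡 n) p).symm z) := by
    refine ((isInvertible_mfderiv_extChartAt hz').inverse_apply_eq.2 ?_).symm
    exact (DFunLike.congr_fun h2 u).symm
  simp only [Function.comp_apply, h3]

lemma contDiffOn_chartForm (g : SmoothRiemannianMetric n M) (p : M) :
    ContDiffOn ℝ ∞ (chartForm g p) (extChartAt (𝓡 n) p).target := by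
  rw [contDiffOn_clm_apply]
  intro u
  rw [contDiffOn_clm_apply]
  intro v y hy
  have : ContMDiffAt 𝓘(ℝ, 𝔼) ((𝓡 n).prod 𝓘(ℝ)) ∞
      (fun z => Bundle.TotalSpace.mk' ℝ (E := Bundle.Trivial M ℝ) ((extChartAt (𝓡 n) p).symm z)
        (chartForm g p z u v)) y := by
    simp only [chartForm_apply]
    apply ContMDiffAt.clm_bundle_apply₂ (F₁ := 𝔼) (F₂ := 𝔼)
    · exact ContMDiffAt.comp y g.contMDiff.contMDiffAt (contMDiffAt_extChartAt_symm_of_mem p hy)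
    · exact contMDiffAt_chartSymmDeriv p hy u
    · exact contMDiffAt_chartSymmDeriv p hy v
  simp only [Bundle.contMDiffAt_totalSpace] at this
  exact this.2.contDiffAt.contDiffWithinAt

/-- The scalar curvature in terms of the structure functions of an orthonormal frame. -/
lemma scalarCurvature_eq_frameScalar {g : SmoothRiemannianMetric n M}
    {e : ι → ∀ x : M, TangentSpace (𝓡 n) x} (h : IsOrthonormalFrameOn g O e) {p : M}
    (hp : p ∈ O) :
    scalarCurvature g p = frameScalar (fun a b d => structureFunctionM g e a b d p)
      (fun a b => structureDerivM g e a b p) := by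
  set φ := extChartAt (𝓡 n) p with hφ
  set O' : Set 𝔼 := φ.target ∩ φ.symm ⁻¹' O with hO'
  have hO'_open : IsOpen O' :=
    (continuousOn_extChartAt_symm p).isOpen_inter_preimage (isOpen_extChartAt_target p) h.isOpen
  set e' : ι → 𝔼 → 𝔼 := fun a => VectorField.mpullback 𝓘(ℝ, 𝔼) (𝓡 n) φ.symm (e a) with he'
  have hpull : ∀ y ∈ O', ∀ v : TangentSpace (𝓡 n) (φ.symm y),
      chartSymmDeriv p y ((chartSymmDeriv p y).inverse v) = v := by
    intro y hy v
    exact (isInvertible_chartSymmDeriv p hy.1).self_apply_inverse v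
  have hDe' : ∀ y ∈ O', ∀ a, chartSymmDeriv p y (e' a y) = e a (φ.symm y) :=
    fun y hy a => hpull y hy _
  -- Naturality of the Lie bracket under pullback: the frame in the chart has the same structure
  -- functions.
  have hstr : ∀ a b d, ∀ y ∈ O', structureFunction (chartForm g p) e' a b d y =
      structureFunctionM g e a b d (φ.symm y) := by
    intro a b d y hy
    have : IsManifold (𝓡 n) (minSmoothness ℝ 2) M := isManifold_minSmoothness
    have h1 := VectorField.mpullback_mlieBracket (n := ∞) (x₀ := y) (f := φ.symm)
      ((h.smooth a).mdifferentiableAt h.isOpen hy.2) ((h.smooth b).mdifferentiableAt h.isOpen hy.2)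
      (contMDiffAt_extChartAt_symm_of_mem p hy.1) (by simpa using ENat.LEInfty.out)
    rw [structureFunction, chartForm_apply, hDe' y hy]
    have h2 : VectorField.lieBracket ℝ (e' a) (e' b) y =
      VectorField.mpullback 𝓘(ℝ, 𝔼) (𝓡 n) φ.symm (VectorField.mlieBracket (𝓡 n) (e a) (e b)) y :=
      (congrFun (mlieBracket_vectorSpace (e' a) (e' b)) y).symm.trans h1.symm
    rw [h2, VectorField.mpullback_apply]
    exact congrArg (fun v => g.inner _ v _) (hpull y hy _)
  have hy0 : φ p ∈ O' := ⟨mem_extChartAt_target p, by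
    simpa [hφ, extChartAt_to_inv p] using hp⟩
  have hsymm : φ.symm (φ p) = p := extChartAt_to_inv p
  have main := scalarCoord_eq_frameScalar (O := O') (B := chartForm g p) (e := e')
    (G := chartMatrix g p) hO'_open ((contDiffOn_chartForm g p).mono Set.inter_subset_left)
    ?_ ?_ ?_ ?_ ?_ hy0
  · rw [scalarCurvature, main]
    congr 1
    · funext a b d
      rw [hstr a b d _ hy0, hsymm]
    · funext a b
      simp only [structureDerivM]
      have h1 : structureFunction (chartForm g p) e' a b b =ᶠ[𝓝 (φ p)]
          structureFunctionM g e a b b ∘ φ.symm := by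
        filter_upwards [hO'_open.mem_nhds hy0] with y hy using hstr a b b y hy
      have h2 : MDifferentiableAt (𝓡 n) 𝓘(ℝ, ℝ) (structureFunctionM g e a b b)
          (φ.symm (φ p)) :=
        ((h.smooth_structureFunctionM a b b).contMDiffAt (h.isOpen.mem_nhds hy0.2)).mdifferentiableAt
          (by simp)
      have h3 : MDifferentiableAt 𝓘(ℝ, 𝔼) (𝓡 n) φ.symm (φ p) :=
        (contMDiffAt_extChartAt_symm_of_mem p hy0.1).mdifferentiableAt (by simp)
      have h4 := mfderiv_comp (φ p) h2 h3
      rw [h1.fderiv_eq, ← mfderiv_eq_fderiv, h4]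
      -- The base point φ.symm (φ p) equals p only propositionally and occurs in the types, so it is
      -- generalised before substitution.
      have h5 : ∀ x, x = p → mfderiv (𝓡 n) 𝓘(ℝ, ℝ) (structureFunctionM g e a b b) x (e a x) =
        mfderiv (𝓡 n) 𝓘(ℝ, ℝ) (structureFunctionM g e a b b) p (e a p) := by
        rintro x rfl; rfl
      rw [← h5 _ hsymm, ← hDe' _ hy0]
      rfl
  · intro a y hy
    have h1 : ContMDiffAt 𝓘(ℝ, 𝔼) 𝓘(ℝ, 𝔼).tangent ∞
        (fun z => (⟨z, e' a z⟩ : TangentBundle 𝓘(ℝ, 𝔼) 𝔼)) y :=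
      ContMDiffAt.mpullback_vectorField_preimage (n := ∞)
        ((h.smooth a).contMDiffAt (h.isOpen.mem_nhds hy.2))
        (contMDiffAt_extChartAt_symm_of_mem p hy.1) (isInvertible_chartSymmDeriv p hy.1) (by simp)
    exact (contMDiffAt_vectorSpace_iff_contDiffAt.1 h1).contDiffWithinAt
  · intro y _ u v
    exact g.symm _ _ _
  · intro y hy a b
    rw [chartForm_apply, hDe' y hy, hDe' y hy]
    exact h.orthonormal _ hy.2 a b
  · intro y hy v
    apply (isInvertible_chartSymmDeriv p hy.1).injective
    simp only [map_sum, map_smul, chartForm_apply, hDe' y hy]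
    exact h.spanning _ hy.2 (chartSymmDeriv p y v)
  · intro y _ i j
    rfl

end ManifoldFrames

/-! ### Rescaled frames and orthonormal frames of distributions -/

section OrthonormalFamilies

variable {n : ℕ} {M : Type*} [TopologicalSpace M] [ChartedSpace (EuclideanSpace ℝ (Fin n)) M]
  [IsManifold (𝓡 n) ∞ M] {O : Set M} {ι : Type*} [Fintype ι] [DecidableEq ι]

local notation "𝔼" => EuclideanSpace ℝ (Fin n)

/-- Rescaling an orthonormal frame to one of a metric `g'` rescales the structure functions. -/
lemma scalarCurvature_rescaled {g g' : SmoothRiemannianMetric n M}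
    {e : ι → ∀ x : M, TangentSpace (𝓡 n) x} (h : IsOrthonormalFrameOn g O e) {c : ι → ℝ}
    (hc : ∀ a, c a ≠ 0)
    (hg' : ∀ x ∈ O, ∀ (v : TangentSpace (𝓡 n) x) (a : ι),
      g'.inner x v (e a x) = (c a ^ 2)⁻¹ * g.inner x v (e a x)) {p : M} (hp : p ∈ O) :
    scalarCurvature g' p =
      frameScalar (fun a b d => c a * c b / c d * structureFunctionM g e a b d p)
        (fun a b => c a ^ 2 * structureDerivM g e a b p) := by
  have hframe : IsOrthonormalFrameOn g' O (fun a => c a • e a) := by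
    refine ⟨h.isOpen, fun a => ContMDiffOn.const_smul_section (h.smooth a), ?_, ?_⟩
    · intro x hx a b
      simp only [Pi.smul_apply, map_smul, smul_apply, hg' x hx, h.orthonormal x hx, smul_eq_mul]
      have := hc a
      have := hc b
      split_ifs with hab
      · subst hab
        field_simp
      · simp
    · intro x hx v
      conv_lhs => rw [h.spanning x hx v]
      refine Finset.sum_congr rfl fun a _ => ?_
      simp only [Pi.smul_apply, map_smul, hg' x hx, smul_eq_mul, smul_smul]
      congr 1
      have := hc a
      field_simp
  have hstr : ∀ a b d, ∀ x ∈ O, structureFunctionM g' (fun a => c a • e a) a b d x =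
      c a * c b / c d * structureFunctionM g e a b d x := by
    intro a b d x hx
    have : IsManifold (𝓡 n) (minSmoothness ℝ 2) M := isManifold_minSmoothness
    have ha := (h.smooth a).mdifferentiableAt h.isOpen hx
    have hb := (h.smooth b).mdifferentiableAt h.isOpen hx
    have hb' := (hframe.smooth b).mdifferentiableAt h.isOpen hx
    simp only [structureFunctionM]
    rw [VectorField.mlieBracket_const_smul_left ha, VectorField.mlieBracket_const_smul_right hb]
    simp only [Pi.smul_apply, map_smul, smul_apply, hg' x hx, smul_eq_mul]
    have := hc d
    field_simp
  rw [scalarCurvature_eq_frameScalar hframe hp]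
  congr 1
  · funext a b d
    exact hstr a b d p hp
  · funext a b
    -- For d = b the factor c_a c_b / c_d is c_a; differentiating along c_a e_a supplies the second
    -- c_a.
    have h1 : structureFunctionM g' (fun a => c a • e a) a b b =ᶠ[𝓝 p]
        c a • structureFunctionM g e a b b := by
      filter_upwards [h.isOpen.mem_nhds hp] with x hx
      rw [hstr a b b x hx, Pi.smul_apply, smul_eq_mul]
      have := hc b
      field_simp
    have h2 : MDifferentiableAt (𝓡 n) 𝓘(ℝ, ℝ) (structureFunctionM g e a b b) p :=
      ((h.smooth_structureFunctionM a b b).contMDiffAt (h.isOpen.mem_nhds hp)).mdifferentiableAt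
        (by simp)
    rw [structureDerivM, h1.mfderiv_eq, (h2.hasMFDerivAt.const_smul (c a)).mfderiv]
    set L : TangentSpace (𝓡 n) p →L[ℝ] ℝ :=
      mfderiv (𝓡 n) 𝓘(ℝ, ℝ) (structureFunctionM g e a b b) p with hL
    change (c a • L) (c a • e a p) = c a ^ 2 * L (e a p)
    simp only [map_smul, smul_apply, smul_eq_mul]
    ring

omit [IsManifold (𝓡 n) ∞ M] in
lemma eq_sum_inner_smul_of_mem_span {x : M} {κ : Type*} [Fintype κ] [DecidableEq κ]
    {B : TangentSpace (𝓡 n) x →L[ℝ] TangentSpace (𝓡 n) x →L[ℝ] ℝ}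
    {b : κ → TangentSpace (𝓡 n) x} (hb : ∀ i j, B (b i) (b j) = if i = j then 1 else 0)
    {v : TangentSpace (𝓡 n) x} (hv : v ∈ Submodule.span ℝ (Set.range b)) :
    v = ∑ i, B v (b i) • b i := by
  obtain ⟨t, rfl⟩ := (Submodule.mem_span_range_iff_exists_fun ℝ).1 hv
  refine Finset.sum_congr rfl fun i _ => ?_
  simp [hb]

/-- `b` is a smooth `g`-orthonormal frame of the distribution `Y` on the open set `O`. -/
structure IsOrthonormalFamilyOn (g : SmoothRiemannianMetric n M) (O : Set M)
    (Y : ∀ x : M, Submodule ℝ (TangentSpace (𝓡 n) x))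
    (b : ι → ∀ x : M, TangentSpace (𝓡 n) x) : Prop where
  isOpen : IsOpen O
  smooth : ∀ a, SmoothFieldOn (b a) O
  orthonormal : ∀ x ∈ O, ∀ i j, g.inner x (b i x) (b j x) = if i = j then 1 else 0
  span_eq : ∀ x ∈ O, Submodule.span ℝ (Set.range fun a => b a x) = Y x

/-- Smooth Gram-Schmidt orthonormalization. -/
lemma exists_smooth_orthonormal (g : SmoothRiemannianMetric n M) (k : ℕ)
    (e : Fin k → ∀ x : M, TangentSpace (𝓡 n) x) (he : ∀ a, SmoothFieldOn (e a) O)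
    (hli : ∀ x ∈ O, LinearIndependent ℝ fun a => e a x) :
    ∃ b : Fin k → ∀ x : M, TangentSpace (𝓡 n) x, (∀ a, SmoothFieldOn (b a) O) ∧
      (∀ x ∈ O, ∀ i j, g.inner x (b i x) (b j x) = if i = j then 1 else 0) ∧
      ∀ x ∈ O, Submodule.span ℝ (Set.range fun a => b a x) =
        Submodule.span ℝ (Set.range fun a => e a x) := by
  induction k with
  | zero => exact ⟨e, he, fun _ _ i => i.elim0, fun _ _ => rfl⟩
  | succ k ih =>
    obtain ⟨b, hb, hbo, hbs⟩ := ih (fun a => e a.castSucc) (fun a => he _)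
      (fun x hx => (linearIndependent_finSucc'.1 (hli x hx)).1)
    set u := e (Fin.last k) with hu
    set w : ∀ x : M, TangentSpace (𝓡 n) x :=
      fun x => u x - ∑ i, g.inner x (u x) (b i x) • b i x with hw
    have hws : SmoothFieldOn w O := by
      have h1 : SmoothFieldOn (fun x => ∑ i, g.inner x (u x) (b i x) • b i x) O :=
        ContMDiffOn.sum_section fun i _ =>
          ContMDiffOn.smul_section (SmoothFieldOn.inner g (he _) (hb i)) (hb i)
      exact ContMDiffOn.sub_section (he _) h1
    have hwb : ∀ x ∈ O, ∀ j, g.inner x (w x) (b j x) = 0 := by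
      intro x hx j
      simp [hw, hbo x hx]
    have hspan : ∀ x ∈ O, ∀ i, b i x ∈ Submodule.span ℝ (Set.range fun a => b a x) :=
      fun x _ i => Submodule.subset_span ⟨i, rfl⟩
    -- If the residual vanished, the last vector would lie in the span of the earlier ones, against
    -- linear independence. Nonvanishing is what makes the normalising factor ν smooth.
    have hw0 : ∀ x ∈ O, w x ≠ 0 := by
      intro x hx h0
      have h1 : u x ∈ Submodule.span ℝ (Set.range fun a => b a x) := by
        rw [hw] at h0
        rw [sub_eq_zero.1 h0]
        exact Submodule.sum_mem _ fun i _ => Submodule.smul_mem _ _ (hspan x hx i)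
      rw [hbs x hx] at h1
      exact (linearIndependent_finSucc'.1 (hli x hx)).2 h1
    have hpos : ∀ x ∈ O, 0 < g.inner x (w x) (w x) := fun x hx => g.pos x _ (hw0 x hx)
    set ν : M → ℝ := fun x => (√(g.inner x (w x) (w x)))⁻¹ with hν
    have hν0 : ∀ x ∈ O, ν x ≠ 0 := fun x hx => inv_ne_zero (Real.sqrt_ne_zero'.2 (hpos x hx))
    have hνsq : ∀ x ∈ O, ν x * (ν x * g.inner x (w x) (w x)) = 1 := by
      intro x hx
      have h1 := Real.mul_self_sqrt (hpos x hx).le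
      have h2 := Real.sqrt_ne_zero'.2 (hpos x hx)
      simp only [hν]
      field_simp
      rw [sq, h1]
    have hνs : ContMDiffOn (𝓡 n) 𝓘(ℝ, ℝ) ∞ ν O := by
      intro x hx
      have h1 : ContDiffAt ℝ ∞ (fun t : ℝ => (√t)⁻¹) (g.inner x (w x) (w x)) :=
        (Real.contDiffAt_sqrt (hpos x hx).ne').inv (Real.sqrt_ne_zero'.2 (hpos x hx))
      exact ContMDiffAt.comp_contMDiffWithinAt (I' := 𝓘(ℝ, ℝ)) (g := fun t : ℝ => (√t)⁻¹) x
        h1.contMDiffAt (SmoothFieldOn.inner g hws hws x hx)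
    refine ⟨Fin.snoc (α := fun _ => ∀ x : M, TangentSpace (𝓡 n) x) b (ν • w), ?_, ?_, ?_⟩
    · intro a
      refine Fin.lastCases ?_ (fun a => ?_) a
      · simp only [Fin.snoc_last]
        exact ContMDiffOn.smul_section hνs hws
      · simp only [Fin.snoc_castSucc]
        exact hb a
    · intro x hx i j
      refine Fin.lastCases ?_ (fun i => ?_) i <;> refine Fin.lastCases ?_ (fun j => ?_) j
      · simp [hνsq x hx]
      · simp [hwb x hx, (Fin.castSucc_lt_last j).ne']
      · have : g.inner x (b i x) (w x) = 0 := by rw [g.symm, hwb x hx]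
        simp [this, (Fin.castSucc_lt_last i).ne]
      · simp [hbo x hx]
    · intro x hx
      have hbe : ∀ i, b i x ∈ Submodule.span ℝ (Set.range fun a => e a x) := by
        intro i
        have h1 := hspan x hx i
        rw [hbs x hx] at h1
        refine Submodule.span_mono ?_ h1
        rintro _ ⟨a, rfl⟩
        exact ⟨a.castSucc, rfl⟩
      apply le_antisymm
      · rw [Submodule.span_le]
        rintro _ ⟨a, rfl⟩
        refine Fin.lastCases ?_ (fun a => ?_) a
        · simp only [Fin.snoc_last]
          refine Submodule.smul_mem _ _ (Submodule.sub_mem _ (Submodule.subset_span ⟨_, rfl⟩) ?_)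
          exact Submodule.sum_mem _ fun i _ => Submodule.smul_mem _ _ (hbe i)
        · simp only [Fin.snoc_castSucc]
          exact hbe a
      · rw [Submodule.span_le]
        set S := Submodule.span ℝ (Set.range fun a =>
          Fin.snoc (α := fun _ => ∀ x : M, TangentSpace (𝓡 n) x) b (ν • w) a x) with hS
        have hbS : ∀ i, b i x ∈ S := fun i => Submodule.subset_span ⟨i.castSucc, by simp⟩
        have hbS' : Submodule.span ℝ (Set.range fun a => b a x) ≤ S := by
          rw [Submodule.span_le]
          rintro _ ⟨a, rfl⟩
          exact hbS a
        have hwS : w x ∈ S := by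
          have h1 : ν x • w x ∈ S := Submodule.subset_span ⟨Fin.last k, by simp⟩
          exact (Submodule.smul_mem_iff _ (hν0 x hx)).1 h1
        rintro _ ⟨a, rfl⟩
        refine Fin.lastCases ?_ (fun a => ?_) a
        · have h1 : u x = w x + ∑ i, g.inner x (u x) (b i x) • b i x := by simp [hw]
          change u x ∈ S
          rw [h1]
          exact Submodule.add_mem _ hwS
            (Submodule.sum_mem _ fun i _ => Submodule.smul_mem _ _ (hbS i))
        · apply hbS'
          rw [hbs x hx]
          exact Submodule.subset_span ⟨a, rfl⟩

lemma IsSmoothSubbundle.exists_isOrthonormalFamilyOn {k : ℕ}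
    {Y : ∀ x : M, Submodule ℝ (TangentSpace (𝓡 n) x)} (hY : IsSmoothSubbundle k Y)
    (g : SmoothRiemannianMetric n M) (p : M) :
    ∃ O : Set M, p ∈ O ∧ ∃ b : Fin k → ∀ x : M, TangentSpace (𝓡 n) x,
      IsOrthonormalFamilyOn g O Y b := by
  obtain ⟨O, hO, hp, e, he, hes⟩ := hY p
  obtain ⟨b, hb, hbo, hbs⟩ := exists_smooth_orthonormal g k e he fun x hx => (hes x hx).1
  exact ⟨O, hp, b, hO, hb, hbo, fun x hx => (hbs x hx).trans (hes x hx).2⟩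

omit [Fintype ι] in
lemma IsOrthonormalFamilyOn.mono {g : SmoothRiemannianMetric n M}
    {Y : ∀ x : M, Submodule ℝ (TangentSpace (𝓡 n) x)} {b : ι → ∀ x : M, TangentSpace (𝓡 n) x}
    (h : IsOrthonormalFamilyOn g O Y b) {O' : Set M} (hO' : IsOpen O') (hs : O' ⊆ O) :
    IsOrthonormalFamilyOn g O' Y b :=
  ⟨hO', fun a => (h.smooth a).mono hs, fun x hx => h.orthonormal x (hs hx),
    fun x hx => h.span_eq x (hs hx)⟩

omit [Fintype ι] in
lemma IsOrthonormalFamilyOn.mem {g : SmoothRiemannianMetric n M}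
    {Y : ∀ x : M, Submodule ℝ (TangentSpace (𝓡 n) x)} {b : ι → ∀ x : M, TangentSpace (𝓡 n) x}
    (h : IsOrthonormalFamilyOn g O Y b) {x : M} (hx : x ∈ O) (a : ι) : b a x ∈ Y x := by
  rw [← h.span_eq x hx]
  exact Submodule.subset_span ⟨a, rfl⟩

lemma IsOrthonormalFamilyOn.eq_sum {g : SmoothRiemannianMetric n M}
    {Y : ∀ x : M, Submodule ℝ (TangentSpace (𝓡 n) x)} {b : ι → ∀ x : M, TangentSpace (𝓡 n) x}
    (h : IsOrthonormalFamilyOn g O Y b) {x : M} (hx : x ∈ O) {v : TangentSpace (𝓡 n) x}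
    (hv : v ∈ Y x) : v = ∑ a, g.inner x v (b a x) • b a x := by
  apply eq_sum_inner_smul_of_mem_span (h.orthonormal x hx)
  rwa [h.span_eq x hx]

/-- Orthonormal frames of complementary orthogonal distributions form a frame of `TM`. -/
lemma IsOrthonormalFamilyOn.sumElim {κ : Type*} [Fintype κ] [DecidableEq κ]
    {g : SmoothRiemannianMetric n M}
    {X Y : ∀ x : M, Submodule ℝ (TangentSpace (𝓡 n) x)} {a : ι → ∀ x : M, TangentSpace (𝓡 n) x}
    {b : κ → ∀ x : M, TangentSpace (𝓡 n) x}
    (ha : IsOrthonormalFamilyOn g O X a) (hb : IsOrthonormalFamilyOn g O Y b)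
    (hXY : ∀ x : M, IsCompl (X x) (Y x) ∧ ∀ u ∈ X x, ∀ v ∈ Y x, g.inner x u v = 0) :
    IsOrthonormalFrameOn g O (Sum.elim a b) := by
  refine ⟨ha.isOpen, ?_, ?_, ?_⟩
  · rintro (i | i)
    exacts [ha.smooth i, hb.smooth i]
  · rintro x hx (i | i) (j | j)
    · simp [ha.orthonormal x hx]
    · simp [(hXY x).2 _ (ha.mem hx i) _ (hb.mem hx j)]
    · simp [g.symm x (b i x), (hXY x).2 _ (ha.mem hx j) _ (hb.mem hx i)]
    · simp [hb.orthonormal x hx]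
  · intro x hx v
    have hv : v ∈ X x ⊔ Y x := by rw [(hXY x).1.sup_eq_top]; trivial
    obtain ⟨u, hu, w, hw, rfl⟩ := Submodule.mem_sup.1 hv
    have h1 : ∀ j, g.inner x u (b j x) = 0 := fun j => (hXY x).2 u hu _ (hb.mem hx j)
    have h2 : ∀ i, g.inner x w (a i x) = 0 := fun i => by
      rw [g.symm]; exact (hXY x).2 _ (ha.mem hx i) w hw
    simp only [Fintype.sum_sum_type, Sum.elim_inl, Sum.elim_inr, map_add, add_apply, h1, h2,
      add_zero, zero_add]
    rw [← ha.eq_sum hx hu, ← hb.eq_sum hx hw]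

end OrthonormalFamilies

/-! ### Existence and smoothness of the collapsed metric -/

section CollapsedMetric

variable {n : ℕ} {M : Type*} [TopologicalSpace M] [ChartedSpace (EuclideanSpace ℝ (Fin n)) M]
  [IsManifold (𝓡 n) ∞ M] {O : Set M} {κ : Type*} [Fintype κ]

local notation "𝔼" => EuclideanSpace ℝ (Fin n)

/-- The bilinear form `(u, v) ↦ ∑ g(b_i, u) g(b_i, v)`. -/
def squareForm (g : SmoothRiemannianMetric n M) (x : M) (b : κ → TangentSpace (𝓡 n) x) :
    TangentSpace (𝓡 n) x →L[ℝ] TangentSpace (𝓡 n) x →L[ℝ] ℝ :=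
  ∑ i, (g.inner x (b i)).smulRight (g.inner x (b i))

lemma squareForm_apply (g : SmoothRiemannianMetric n M) (x : M) (b : κ → TangentSpace (𝓡 n) x)
    (u v : TangentSpace (𝓡 n) x) :
    squareForm g x b u v = ∑ i, g.inner x (b i) u * g.inner x (b i) v := by
  simp [squareForm, sum_apply]

/-- In a local trivialization, θ ↦ θ ⊗ θ becomes a fixed smooth map between vector spaces, applied
to the local representative of θ. -/
lemma contMDiffAt_smulRight_self {θ : ∀ x : M, TangentSpace (𝓡 n) x →L[ℝ] ℝ} {p : M}
    (hθ : ContMDiffAt (𝓡 n) ((𝓡 n).prod 𝓘(ℝ, 𝔼 →L[ℝ] ℝ)) ∞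
      (fun x => Bundle.TotalSpace.mk' (𝔼 →L[ℝ] ℝ)
        (E := fun x : M => TangentSpace (𝓡 n) x →L[ℝ] Bundle.Trivial M ℝ x) x (θ x)) p) :
    ContMDiffAt (𝓡 n) ((𝓡 n).prod 𝓘(ℝ, 𝔼 →L[ℝ] 𝔼 →L[ℝ] ℝ)) ∞
      (fun x => Bundle.TotalSpace.mk' (𝔼 →L[ℝ] 𝔼 →L[ℝ] ℝ)
        (E := fun x : M => TangentSpace (𝓡 n) x →L[ℝ] TangentSpace (𝓡 n) x →L[ℝ]
          Bundle.Trivial M ℝ x) x ((θ x).smulRight (θ x))) p := by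
  rw [Bundle.contMDiffAt_section] at hθ ⊢
  have h1 : ContDiff ℝ ∞ fun t : 𝔼 →L[ℝ] ℝ => t.smulRight t := by
    rw [contDiff_clm_apply_iff]
    intro u
    change ContDiff ℝ ∞ fun t : 𝔼 →L[ℝ] ℝ => t u • t
    fun_prop
  have h2 := h1.contDiffAt.contMDiffAt.comp p hθ
  refine h2.congr_of_eventuallyEq ?_
  have hnhds : (trivializationAt (𝔼 →L[ℝ] ℝ)
      (fun x : M => TangentSpace (𝓡 n) x →L[ℝ] Bundle.Trivial M ℝ x) p).baseSet ∈ 𝓝 p :=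
    (Bundle.Trivialization.open_baseSet _).mem_nhds (FiberBundle.mem_baseSet_trivializationAt' p)
  filter_upwards [hnhds] with x hx
  ext u v
  simp only [hom_trivializationAt_apply, ContinuousLinearMap.inCoordinates, Function.comp_apply,
    ContinuousLinearMap.comp_apply, ContinuousLinearMap.smulRight_apply, map_smul, smul_apply,
    Bundle.Trivialization.continuousLinearMapAt_apply,
    Bundle.Trivialization.coe_linearMapAt_of_mem _ hx]
  simp

lemma IsOrthonormalFamilyOn.contMDiffAt_squareForm [DecidableEq κ] {g : SmoothRiemannianMetric n M}
    {Y : ∀ x : M, Submodule ℝ (TangentSpace (𝓡 n) x)} {b : κ → ∀ x : M, TangentSpace (𝓡 n) x}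
    (h : IsOrthonormalFamilyOn g O Y b) {p : M} (hp : p ∈ O) :
    ContMDiffAt (𝓡 n) ((𝓡 n).prod 𝓘(ℝ, 𝔼 →L[ℝ] 𝔼 →L[ℝ] ℝ)) ∞
      (fun x => Bundle.TotalSpace.mk' (𝔼 →L[ℝ] 𝔼 →L[ℝ] ℝ)
        (E := fun x : M => TangentSpace (𝓡 n) x →L[ℝ] TangentSpace (𝓡 n) x →L[ℝ]
          Bundle.Trivial M ℝ x) x (squareForm g x fun i => b i x)) p := by
  refine ContMDiffAt.sum_section fun i _ => contMDiffAt_smulRight_self ?_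
  exact ContMDiffAt.clm_bundle_apply g.contMDiff.contMDiffAt
    ((h.smooth i).contMDiffAt (h.isOpen.mem_nhds hp))

lemma IsOrthonormalFamilyOn.squareForm_of_mem [DecidableEq κ] {g : SmoothRiemannianMetric n M}
    {Y : ∀ x : M, Submodule ℝ (TangentSpace (𝓡 n) x)} {b : κ → ∀ x : M, TangentSpace (𝓡 n) x}
    (h : IsOrthonormalFamilyOn g O Y b) {x : M} (hx : x ∈ O) {u : TangentSpace (𝓡 n) x}
    (hu : u ∈ Y x) (v : TangentSpace (𝓡 n) x) :
    squareForm g x (fun i => b i x) u v = g.inner x u v := by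
  conv_rhs => rw [h.eq_sum hx hu]
  rw [squareForm_apply, map_sum, sum_apply]
  refine Finset.sum_congr rfl fun i _ => ?_
  rw [map_smul, smul_apply, smul_eq_mul, g.symm x u]

lemma IsOrthonormalFamilyOn.squareForm_of_orthogonal [DecidableEq κ]
    {g : SmoothRiemannianMetric n M} {Y : ∀ x : M, Submodule ℝ (TangentSpace (𝓡 n) x)}
    {b : κ → ∀ x : M, TangentSpace (𝓡 n) x} (h : IsOrthonormalFamilyOn g O Y b) {x : M}
    (hx : x ∈ O) {u : TangentSpace (𝓡 n) x} (hu : ∀ w ∈ Y x, g.inner x u w = 0)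
    (v : TangentSpace (𝓡 n) x) : squareForm g x (fun i => b i x) u v = 0 := by
  rw [squareForm_apply]
  refine Finset.sum_eq_zero fun i _ => ?_
  rw [g.symm x _ u, hu _ (h.mem hx i), zero_mul]

lemma contMDiffAt_sub_smul {A B : ∀ x : M, TangentSpace (𝓡 n) x →L[ℝ] TangentSpace (𝓡 n) x →L[ℝ] ℝ}
    {p : M} (hA : ContMDiffAt (𝓡 n) ((𝓡 n).prod 𝓘(ℝ, 𝔼 →L[ℝ] 𝔼 →L[ℝ] ℝ)) ∞
      (fun x => Bundle.TotalSpace.mk' (𝔼 →L[ℝ] 𝔼 →L[ℝ] ℝ)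
        (E := fun x : M => TangentSpace (𝓡 n) x →L[ℝ] TangentSpace (𝓡 n) x →L[ℝ]
          Bundle.Trivial M ℝ x) x (A x)) p)
    (hB : ContMDiffAt (𝓡 n) ((𝓡 n).prod 𝓘(ℝ, 𝔼 →L[ℝ] 𝔼 →L[ℝ] ℝ)) ∞
      (fun x => Bundle.TotalSpace.mk' (𝔼 →L[ℝ] 𝔼 →L[ℝ] ℝ)
        (E := fun x : M => TangentSpace (𝓡 n) x →L[ℝ] TangentSpace (𝓡 n) x →L[ℝ]
          Bundle.Trivial M ℝ x) x (B x)) p) (c : ℝ) :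
    ContMDiffAt (𝓡 n) ((𝓡 n).prod 𝓘(ℝ, 𝔼 →L[ℝ] 𝔼 →L[ℝ] ℝ)) ∞
      (fun x => Bundle.TotalSpace.mk' (𝔼 →L[ℝ] 𝔼 →L[ℝ] ℝ)
        (E := fun x : M => TangentSpace (𝓡 n) x →L[ℝ] TangentSpace (𝓡 n) x →L[ℝ]
          Bundle.Trivial M ℝ x) x (A x - c • B x)) p := by
  have h1 := ContMDiffAt.const_smul_section (a := c) hB
  exact ContMDiffAt.sub_section hA h1

/-- The metric is g - (1 - 1/f²) B, where B is g composed with the orthogonal projections to Y.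
Locally B is the `squareForm` of an orthonormal frame of Y, which gives its smoothness. -/
lemma exists_isCollapsedMetric {g : SmoothRiemannianMetric n M} {r s : ℕ}
    {X Y : ∀ x : M, Submodule ℝ (TangentSpace (𝓡 n) x)} (hXY : IsOrthogonalSplitting g r s X Y)
    {f : ℝ} (hf : 1 ≤ f) : ∃ g' : SmoothRiemannianMetric n M, IsCollapsedMetric g X Y f g' := by
  obtain ⟨-, hY, hc⟩ := hXY
  choose O hp b hb using fun p => hY.exists_isOrthonormalFamilyOn g p
  set B : ∀ x : M, TangentSpace (𝓡 n) x →L[ℝ] TangentSpace (𝓡 n) x →L[ℝ] ℝ :=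
    fun x => squareForm g x fun i => b x i x with hB
  have hdec : ∀ (x : M) (v : TangentSpace (𝓡 n) x), ∃ u ∈ X x, ∃ w ∈ Y x, v = u + w := by
    intro x v
    have hv : v ∈ X x ⊔ Y x := by rw [(hc x).1.sup_eq_top]; trivial
    obtain ⟨u, hu, w, hw, rfl⟩ := Submodule.mem_sup.1 hv
    exact ⟨u, hu, w, hw, rfl⟩
  have hBX : ∀ x, ∀ u ∈ X x, ∀ v, B x u v = 0 := fun x u hu v =>
    (hb x).squareForm_of_orthogonal (hp x) (fun w hw => (hc x).2 u hu w hw) v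
  have hBY : ∀ x, ∀ u ∈ Y x, ∀ v, B x u v = g.inner x u v := fun x u hu v =>
    (hb x).squareForm_of_mem (hp x) hu v
  -- `B x` is built from the frame chosen at `x` itself, so it is not visibly smooth in `x`.
  -- Independence of the frame lets the single frame chosen at `p` compute it near `p`.
  have hBeq : ∀ p, ∀ x ∈ O p, squareForm g x (fun i => b p i x) = B x := by
    intro p x hx
    ext v v'
    obtain ⟨u, hu, w, hw, rfl⟩ := hdec x v
    rw [map_add, map_add, add_apply, add_apply, hBX x u hu, hBY x w hw,
      (hb p).squareForm_of_mem hx hw,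
      (hb p).squareForm_of_orthogonal hx (fun w hw => (hc x).2 u hu w hw)]
  have hf0 : 0 < f := by linarith
  have hf2 : 1 / f ^ 2 ≤ 1 := by
    rw [div_le_one (by positivity)]
    nlinarith
  have hf2' : 0 < 1 / f ^ 2 := by positivity
  set c : ℝ := 1 - 1 / f ^ 2 with hcdef
  set G : ∀ x : M, TangentSpace (𝓡 n) x →L[ℝ] TangentSpace (𝓡 n) x →L[ℝ] ℝ :=
    fun x => g.inner x - c • B x with hG
  have hGapply : ∀ x u v, G x u v = g.inner x u v - c * B x u v := fun x u v => by
    simp [hG]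
  -- This bound, which uses 1 ≤ f on the X-component, yields positivity and puts the unit ball of
  -- the new form inside f times that of g.
  have hlower : ∀ x v, 1 / f ^ 2 * g.inner x v v ≤ G x v v := by
    intro x v
    obtain ⟨u, hu, w, hw, rfl⟩ := hdec x v
    have h1 := (hc x).2 u hu w hw
    have h2 : g.inner x w u = 0 := by rw [g.symm]; exact h1
    have h3 : 0 ≤ g.inner x u u := by
      by_cases h0 : u = 0
      · simp [h0]
      · exact (g.pos x u h0).le
    simp only [hGapply, map_add, add_apply, hBX x u hu, hBY x w hw, h1, h2]
    nlinarith
  refine ⟨⟨G, ?_, ?_, ?_, ?_⟩, ?_⟩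
  · intro x v w
    simp only [hGapply, hB, squareForm_apply, g.symm x v w, mul_comm]
  · intro x v hv
    exact lt_of_lt_of_le (mul_pos hf2' (g.pos x v hv)) (hlower x v)
  · intro x
    refine ((g.isVonNBounded x).image (f • ContinuousLinearMap.id ℝ _)).subset ?_
    intro v hv
    have hv' : G x v v < 1 := hv
    refine ⟨f⁻¹ • v, ?_, ?_⟩
    · have h1 := hlower x v
      have h2 : g.inner x (f⁻¹ • v) (f⁻¹ • v) = 1 / f ^ 2 * g.inner x v v := by
        simp only [map_smul, smul_apply, smul_eq_mul]
        field_simp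
      change g.inner x (f⁻¹ • v) (f⁻¹ • v) < 1
      linarith
    · simp [smul_smul, hf0.ne']
  · intro p
    have h1 : ContMDiffAt (𝓡 n) ((𝓡 n).prod 𝓘(ℝ, 𝔼 →L[ℝ] 𝔼 →L[ℝ] ℝ)) ∞
      (fun x => Bundle.TotalSpace.mk' (𝔼 →L[ℝ] 𝔼 →L[ℝ] ℝ)
        (E := fun x : M => TangentSpace (𝓡 n) x →L[ℝ] TangentSpace (𝓡 n) x →L[ℝ]
          Bundle.Trivial M ℝ x) x (B x)) p := by
      refine ((hb p).contMDiffAt_squareForm (hp p)).congr_of_eventuallyEq ?_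
      filter_upwards [(hb p).isOpen.mem_nhds (hp p)] with x hx
      rw [hBeq p x hx]
    exact contMDiffAt_sub_smul g.contMDiff.contMDiffAt h1 c
  · intro x
    refine ⟨fun u hu v _ => ?_, fun u hu v _ => ?_, fun u hu v hv => ?_⟩
    · change G x u v = _
      rw [hGapply, hBX x u hu]; ring
    · change G x u v = _
      rw [hGapply, hBY x u hu]; ring
    · change G x u v = _
      rw [hGapply, hBX x u hu, (hc x).2 u hu v hv]; ring

end CollapsedMetric

/-! ### Non-involutivity in terms of structure functions -/

section NonInvolutive

variable {n : ℕ} {M : Type*} [TopologicalSpace M] [ChartedSpace (EuclideanSpace ℝ (Fin n)) M]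
  [IsManifold (𝓡 n) ∞ M] {O : Set M} {ι κ : Type*} [Fintype ι] [DecidableEq ι] [Fintype κ]
  [DecidableEq κ]

/-- Since [U, w b] = U(w) b + w [U, b], the bracket with a section of Y is linear over functions
modulo Y, so a frame of Y suffices for testing. -/
lemma IsOrthonormalFamilyOn.mlieBracket_mem {g : SmoothRiemannianMetric n M}
    {Y : ∀ x : M, Submodule ℝ (TangentSpace (𝓡 n) x)} {b : κ → ∀ x : M, TangentSpace (𝓡 n) x}
    (h : IsOrthonormalFamilyOn g O Y b) {x : M} (hx : x ∈ O) {U W : ∀ x : M, TangentSpace (𝓡 n) x}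
    (hW : SmoothFieldOn W O) (hWY : ∀ y ∈ O, W y ∈ Y y)
    (hU : ∀ i, VectorField.mlieBracket (𝓡 n) U (b i) x ∈ Y x) :
    VectorField.mlieBracket (𝓡 n) U W x ∈ Y x := by
  have : IsManifold (𝓡 n) (minSmoothness ℝ 2) M := isManifold_minSmoothness
  set w : κ → M → ℝ := fun i y => g.inner y (W y) (b i y) with hw
  have hws : ∀ i, MDifferentiableAt (𝓡 n) 𝓘(ℝ, ℝ) (w i) x := fun i =>
    ((SmoothFieldOn.inner g hW (h.smooth i)).contMDiffAt
      (h.isOpen.mem_nhds hx)).mdifferentiableAt (by simp)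
  have hwb : ∀ i, SmoothFieldOn (w i • b i) O := fun i =>
    ContMDiffOn.smul_section (SmoothFieldOn.inner g hW (h.smooth i)) (h.smooth i)
  have hsum : ∀ t : Finset κ, VectorField.mlieBracket (𝓡 n) U (∑ i ∈ t, w i • b i) x ∈ Y x := by
    intro t
    induction t using Finset.induction_on with
    | empty => simp
    | insert i t hi ih =>
      have h1 : SmoothFieldOn (∑ i ∈ t, w i • b i) O := by
        have h2 : SmoothFieldOn (fun x => ∑ i ∈ t, (w i • b i) x) O :=
          ContMDiffOn.sum_section fun i _ => hwb i
        convert h2 using 1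
        ext1 x
        simp
      rw [Finset.sum_insert hi, VectorField.mlieBracket_add_right
        ((hwb i).mdifferentiableAt h.isOpen hx) (h1.mdifferentiableAt h.isOpen hx),
        VectorField.mlieBracket_smul_right (hws i) ((h.smooth i).mdifferentiableAt h.isOpen hx)]
      exact Submodule.add_mem _ (Submodule.add_mem _ (Submodule.smul_mem _ _ (h.mem hx i))
        (Submodule.smul_mem _ _ (hU i))) ih
  have heq : W =ᶠ[𝓝 x] ∑ i, w i • b i := by
    filter_upwards [h.isOpen.mem_nhds hx] with y hy
    exact (h.eq_sum hy (hWY y hy)).trans (Finset.sum_apply y Finset.univ fun i => w i • b i).symm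
  rw [Filter.EventuallyEq.mlieBracket_vectorField_eq (Filter.EventuallyEq.refl _ U) heq]
  exact hsum _

/-- If all these coefficients vanished at `x`, brackets of frame fields of Y would lie in Y there.
Tensoriality modulo Y, applied in each argument in turn, would extend this to all local sections. -/
lemma EverywhereNonInvolutive.exists_structureFunctionM_ne_zero {g : SmoothRiemannianMetric n M}
    {X Y : ∀ x : M, Submodule ℝ (TangentSpace (𝓡 n) x)} {a : ι → ∀ x : M, TangentSpace (𝓡 n) x}
    {b : κ → ∀ x : M, TangentSpace (𝓡 n) x} (hY : EverywhereNonInvolutive Y)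
    (ha : IsOrthonormalFamilyOn g O X a) (hb : IsOrthonormalFamilyOn g O Y b)
    (hXY : ∀ x : M, IsCompl (X x) (Y x) ∧ ∀ u ∈ X x, ∀ v ∈ Y x, g.inner x u v = 0)
    {x : M} (hx : x ∈ O) :
    ∃ i j k, structureFunctionM g (Sum.elim a b) (Sum.inr i) (Sum.inr j) (Sum.inl k) x ≠ 0 := by
  by_contra! h0
  obtain ⟨O', hO', hx', U, W, hU, hW, hUW, hnot⟩ := hY x
  apply hnot
  have hframe := ha.sumElim hb hXY
  have hbb : ∀ i j, VectorField.mlieBracket (𝓡 n) (b i) (b j) x ∈ Y x := by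
    intro i j
    rw [hframe.spanning x hx (VectorField.mlieBracket (𝓡 n) (b i) (b j) x)]
    refine Submodule.sum_mem _ ?_
    rintro (k | k) -
    · have h1 : g.inner x (VectorField.mlieBracket (𝓡 n) (b i) (b j) x) (Sum.elim a b (Sum.inl k) x)
        = 0 := h0 i j k
      rw [h1, zero_smul]
      exact Submodule.zero_mem _
    · exact Submodule.smul_mem _ _ (hb.mem hx k)
  have hb' := hb.mono (O' := O ∩ O') (hb.isOpen.inter hO') Set.inter_subset_left
  have hx2 : x ∈ O ∩ O' := ⟨hx, hx'⟩
  refine hb'.mlieBracket_mem hx2 (hW.mono Set.inter_subset_right) (fun y hy => (hUW y hy.2).2) ?_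
  intro j
  rw [VectorField.mlieBracket_swap_apply]
  refine Submodule.neg_mem _ (hb'.mlieBracket_mem hx2 (hU.mono Set.inter_subset_right)
    (fun y hy => (hUW y hy.2).1) fun i => hbb j i)

omit [Fintype ι] [Fintype κ] in
lemma IsCollapsedMetric.inner_frame {g g' : SmoothRiemannianMetric n M}
    {X Y : ∀ x : M, Submodule ℝ (TangentSpace (𝓡 n) x)} {f : ℝ}
    (h : IsCollapsedMetric g X Y f g')
    (hXY : ∀ x : M, IsCompl (X x) (Y x) ∧ ∀ u ∈ X x, ∀ v ∈ Y x, g.inner x u v = 0)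
    {a : ι → ∀ x : M, TangentSpace (𝓡 n) x} {b : κ → ∀ x : M, TangentSpace (𝓡 n) x}
    (ha : IsOrthonormalFamilyOn g O X a) (hb : IsOrthonormalFamilyOn g O Y b)
    {x : M} (hx : x ∈ O) (v : TangentSpace (𝓡 n) x) (i : ι ⊕ κ) :
    g'.inner x v (Sum.elim a b i x) =
      (Sum.elim (fun _ => (1 : ℝ)) (fun _ => f) i ^ 2)⁻¹ * g.inner x v (Sum.elim a b i x) := by
  have hv : v ∈ X x ⊔ Y x := by rw [(hXY x).1.sup_eq_top]; trivial
  obtain ⟨u, hu, w, hw, rfl⟩ := Submodule.mem_sup.1 hv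
  obtain ⟨h1, h2, h3⟩ := h x
  have h4 := (hXY x).2
  rcases i with i | i
  · have hi := ha.mem hx i
    have e1 : g'.inner x w (a i x) = 0 := by rw [g'.symm]; exact h3 _ hi _ hw
    have e2 : g.inner x w (a i x) = 0 := by rw [g.symm]; exact h4 _ hi _ hw
    simp [e1, e2, h1 u hu _ hi]
  · have hi := hb.mem hx i
    simp [h3 u hu _ hi, h4 u hu _ hi, h2 w hw _ hi]

end NonInvolutive

/-! ### The estimate in powers of f -/

section Negativity

variable {ι κ : Type*} [Fintype ι] [Fintype κ]

/-- The scalar curvature of a collapsed metric grows at most like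
`f² * (first two terms) - f⁴ * (last term)`. -/
lemma frameScalar_collapsed_le (c : ι ⊕ κ → ι ⊕ κ → ι ⊕ κ → ℝ) (dc : ι ⊕ κ → ι ⊕ κ → ℝ) {f : ℝ}
    (hf : 1 ≤ f) {l : ι ⊕ κ → ℝ} (hl : l = Sum.elim (fun _ => 1) (fun _ => f)) :
    frameScalar (fun a b d => l a * l b / l d * c a b d) (fun a b => l a ^ 2 * dc a b) ≤
      f ^ 2 * (2 * ∑ a, ∑ b, |dc a b| + (1 / 2) * ∑ a, ∑ b, ∑ d, |c a b d * c a d b|)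
        - f ^ 4 * ((1 / 4) * ∑ i, ∑ j, ∑ k, c (Sum.inr i) (Sum.inr j) (Sum.inl k) ^ 2) := by
  have hl1 : ∀ a, 0 < l a := by rintro (a | a) <;> simp [hl]; linarith
  have hl2 : ∀ a, l a ^ 2 ≤ f ^ 2 := by rintro (a | a) <;> simp [hl]; rw [abs_of_nonneg] <;> linarith
  have h1 : ∑ a, ∑ b, l a ^ 2 * dc a b ≤ f ^ 2 * ∑ a, ∑ b, |dc a b| := by
    simp only [Finset.mul_sum]
    refine Finset.sum_le_sum fun a _ => Finset.sum_le_sum fun b _ => ?_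
    calc l a ^ 2 * dc a b ≤ l a ^ 2 * |dc a b| :=
          mul_le_mul_of_nonneg_left (le_abs_self _) (sq_nonneg _)
      _ ≤ _ := mul_le_mul_of_nonneg_right (hl2 a) (abs_nonneg _)
  -- This sum enters `frameScalar` with a minus sign, so an upper bound may drop it whatever its
  -- growth in f.
  have h2 : 0 ≤ ∑ d, (∑ a, l d * l a / l a * c d a a) ^ 2 :=
    Finset.sum_nonneg fun _ _ => sq_nonneg _
  have h3 : - ∑ a, ∑ b, ∑ d, (l a * l b / l d * c a b d) * (l a * l d / l b * c a d b) ≤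
      f ^ 2 * ∑ a, ∑ b, ∑ d, |c a b d * c a d b| := by
    simp only [Finset.mul_sum, ← Finset.sum_neg_distrib]
    refine Finset.sum_le_sum fun a _ => Finset.sum_le_sum fun b _ =>
      Finset.sum_le_sum fun d _ => ?_
    -- The weights of b and d cancel, so mixed products grow no faster than f², even though a single
    -- factor may grow like f².
    have e : l a * l b / l d * c a b d * (l a * l d / l b * c a d b) =
        l a ^ 2 * (c a b d * c a d b) := by
      have := (hl1 b).ne'
      have := (hl1 d).ne'
      field_simp
    rw [e]
    calc -(l a ^ 2 * (c a b d * c a d b)) = l a ^ 2 * -(c a b d * c a d b) := by ring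
      _ ≤ l a ^ 2 * |c a b d * c a d b| :=
          mul_le_mul_of_nonneg_left (neg_le_abs _) (sq_nonneg _)
      _ ≤ _ := mul_le_mul_of_nonneg_right (hl2 a) (abs_nonneg _)
  -- Only brackets of two Y-fields with an X-component are kept; their weight is (f · f / 1)².
  have h4 : f ^ 4 * ∑ i, ∑ j, ∑ k, c (Sum.inr i) (Sum.inr j) (Sum.inl k) ^ 2 ≤
      ∑ a, ∑ b, ∑ d, (l a * l b / l d * c a b d) ^ 2 := by
    rw [Fintype.sum_sum_type, Finset.mul_sum]
    refine le_add_of_nonneg_of_le (by positivity) (Finset.sum_le_sum fun i _ => ?_)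
    rw [Fintype.sum_sum_type, Finset.mul_sum]
    refine le_add_of_nonneg_of_le (by positivity) (Finset.sum_le_sum fun j _ => ?_)
    rw [Fintype.sum_sum_type, Finset.mul_sum]
    refine le_add_of_le_of_nonneg (Finset.sum_le_sum fun k _ => ?_) (by positivity)
    simp only [hl, Sum.elim_inl, Sum.elim_inr]
    exact le_of_eq (by ring)
  rw [frameScalar]
  linarith

lemma sum_sq_pos {α β γ : Type*} [Fintype α] [Fintype β] [Fintype γ] {q : α → β → γ → ℝ}
    {i : α} {j : β} {k : γ} (h : q i j k ≠ 0) : 0 < ∑ i, ∑ j, ∑ k, q i j k ^ 2 :=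
  Finset.sum_pos' (fun i _ => by positivity)
    ⟨i, Finset.mem_univ _, Finset.sum_pos' (fun j _ => by positivity)
    ⟨j, Finset.mem_univ _, Finset.sum_pos' (fun k _ => by positivity)
    ⟨k, Finset.mem_univ _, by positivity⟩⟩⟩

end Negativity

/-! ### Local uniformity and the passage to compact sets -/

section Main

variable {n : ℕ} {M : Type*} [TopologicalSpace M] [ChartedSpace (EuclideanSpace ℝ (Fin n)) M]
  [IsManifold (𝓡 n) ∞ M] {O : Set M} {ι : Type*} [Fintype ι] [DecidableEq ι]

lemma IsOrthonormalFrameOn.continuousAt_structureFunctionM {g : SmoothRiemannianMetric n M}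
    {e : ι → ∀ x : M, TangentSpace (𝓡 n) x} (h : IsOrthonormalFrameOn g O e) {p : M}
    (hp : p ∈ O) (a b d : ι) : ContinuousAt (structureFunctionM g e a b d) p :=
  ((h.smooth_structureFunctionM a b d).contMDiffAt (h.isOpen.mem_nhds hp)).continuousAt

/-- The derivative is taken in varying tangent spaces, so continuity comes from the tangent map of
the structure function composed with the section `e a` of the tangent bundle. -/
lemma IsOrthonormalFrameOn.continuousAt_structureDerivM {g : SmoothRiemannianMetric n M}
    {e : ι → ∀ x : M, TangentSpace (𝓡 n) x} (h : IsOrthonormalFrameOn g O e) {p : M}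
    (hp : p ∈ O) (a b : ι) : ContinuousAt (structureDerivM g e a b) p := by
  have h1 := (h.smooth_structureFunctionM a b b).continuousOn_tangentMapWithin (by simp)
    h.isOpen.uniqueMDiffOn
  have h2 : ContinuousOn (fun x => (⟨x, e a x⟩ : TangentBundle (𝓡 n) M)) O :=
    (h.smooth a).continuousOn
  have h3 := h1.comp h2 (fun x hx => hx)
  have h4 : Continuous (fun q : TangentBundle 𝓘(ℝ, ℝ) ℝ => q.2) :=
    (contMDiff_snd_tangentBundle_modelSpace (n := 0) ℝ 𝓘(ℝ, ℝ)).continuous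
  have h5 := (h4.comp_continuousOn h3).continuousAt (h.isOpen.mem_nhds hp)
  refine h5.congr ?_
  filter_upwards [h.isOpen.mem_nhds hp] with x hx
  change mfderivWithin (𝓡 n) 𝓘(ℝ, ℝ) (structureFunctionM g e a b b) O x (e a x) =
    mfderiv (𝓡 n) 𝓘(ℝ, ℝ) (structureFunctionM g e a b b) x (e a x)
  rw [mfderivWithin_of_isOpen h.isOpen hx]

/-- Around every point, the collapsed metrics have negative scalar curvature for large `f`. -/
lemma exists_nhds_scalarCurvature_neg {g : SmoothRiemannianMetric n M} {r s : ℕ}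
    {X Y : ∀ x : M, Submodule ℝ (TangentSpace (𝓡 n) x)} (hXY : IsOrthogonalSplitting g r s X Y)
    (hY : EverywhereNonInvolutive Y) (x₀ : M) :
    ∃ t ∈ 𝓝 x₀, ∃ f₀ : ℝ, ∀ f, f₀ ≤ f → 1 ≤ f → ∀ g' : SmoothRiemannianMetric n M,
      IsCollapsedMetric g X Y f g' → ∀ p ∈ t, scalarCurvature g' p < 0 := by
  obtain ⟨hXs, hYs, hc⟩ := hXY
  obtain ⟨O₁, hx₁, a, ha⟩ := hXs.exists_isOrthonormalFamilyOn g x₀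
  obtain ⟨O₂, hx₂, b, hb⟩ := hYs.exists_isOrthonormalFamilyOn g x₀
  have hO := ha.isOpen.inter hb.isOpen
  have hx₀ : x₀ ∈ O₁ ∩ O₂ := ⟨hx₁, hx₂⟩
  replace ha := ha.mono hO Set.inter_subset_left
  replace hb := hb.mono hO Set.inter_subset_right
  have hframe := ha.sumElim hb hc
  set e := Sum.elim a b with he
  -- `C` and `A` are the coefficients of f² and -f⁴ in `frameScalar_collapsed_le`, as functions of
  -- the point.
  obtain ⟨C, hC⟩ : ∃ C : M → ℝ, C = fun x => 2 * ∑ i, ∑ j, |structureDerivM g e i j x| +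
    (1 / 2) * ∑ i, ∑ j, ∑ k, |structureFunctionM g e i j k x * structureFunctionM g e i k j x| :=
    ⟨_, rfl⟩
  obtain ⟨A, hA⟩ : ∃ A : M → ℝ, A = fun x => (1 / 4) * ∑ i, ∑ j, ∑ k,
    structureFunctionM g e (Sum.inr i) (Sum.inr j) (Sum.inl k) x ^ 2 := ⟨_, rfl⟩
  have hst := hframe.continuousAt_structureFunctionM hx₀
  have hsd := hframe.continuousAt_structureDerivM hx₀
  have hCc : ContinuousAt C x₀ := by
    rw [hC]
    refine ContinuousAt.add (ContinuousAt.mul continuousAt_const ?_)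
      (ContinuousAt.mul continuousAt_const ?_)
    · exact tendsto_finsetSum _ fun i _ => tendsto_finsetSum _ fun j _ => (hsd i j).abs
    · exact tendsto_finsetSum _ fun i _ => tendsto_finsetSum _ fun j _ =>
        tendsto_finsetSum _ fun k _ => ((hst i j k).mul (hst i k j)).abs
  have hAc : ContinuousAt A x₀ := by
    rw [hA]
    refine ContinuousAt.mul continuousAt_const ?_
    exact tendsto_finsetSum _ fun i _ => tendsto_finsetSum _ fun j _ =>
      tendsto_finsetSum _ fun k _ => (hst _ _ _).pow 2
  have hA0 : 0 < A x₀ := by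
    obtain ⟨i, j, k, hne⟩ := hY.exists_structureFunctionM_ne_zero ha hb hc hx₀
    rw [hA]
    exact mul_pos (by norm_num) (sum_sq_pos (i := i) (j := j) (k := k) hne)
  -- Chosen so that C - F A equals -A < 0 at `x₀`; the strict inequality then persists nearby.
  obtain ⟨F, hF⟩ : ∃ F : ℝ, F = C x₀ / A x₀ + 1 := ⟨_, rfl⟩
  have hlt : C x₀ - F * A x₀ < 0 := by
    have : F * A x₀ = C x₀ + A x₀ := by
      rw [hF, add_mul, div_mul_cancel₀ _ hA0.ne', one_mul]
    linarith
  have hev : ∀ᶠ x in 𝓝 x₀, C x - F * A x < 0 :=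
    (hCc.sub (continuousAt_const.mul hAc)).eventually_lt_const hlt
  refine ⟨{x | C x - F * A x < 0} ∩ (O₁ ∩ O₂), Filter.inter_mem hev (hO.mem_nhds hx₀), F, ?_⟩
  rintro f hf hf1 g' hg' p ⟨hp, hpO⟩
  rw [scalarCurvature_rescaled (c := Sum.elim (fun _ => (1 : ℝ)) (fun _ => f)) hframe
    (by rintro (i | i) <;> simp; linarith)
    (fun x hx v i => hg'.inner_frame hc ha hb hx v i) hpO]
  refine (frameScalar_collapsed_le (fun i j k => structureFunctionM g e i j k p)
    (fun i j => structureDerivM g e i j p) hf1 rfl).trans_lt ?_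
  have hAp : 0 ≤ A p := by
    rw [hA]
    exact mul_nonneg (by norm_num) (Finset.sum_nonneg fun i _ => Finset.sum_nonneg fun j _ =>
      Finset.sum_nonneg fun k _ => sq_nonneg _)
  suffices f ^ 2 * C p - f ^ 4 * A p < 0 by rwa [hC, hA] at this
  have hp' : C p - F * A p < 0 := hp
  -- The estimate needs f² ≥ F, which follows from f ≥ F because f ≥ 1. The bound factors as f² (C -
  -- f² A).
  have hfF : F ≤ f ^ 2 := by nlinarith
  have h1 : C p - f ^ 2 * A p < 0 := by nlinarith
  have h2 : 0 < f ^ 2 := by positivity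
  nlinarith

end Main

end

theorem corollary4p5 {n r s : ℕ} {M : Type*} [TopologicalSpace M] [T2Space M]
    [SecondCountableTopology M] [ChartedSpace (EuclideanSpace ℝ (Fin n)) M]
    [IsManifold (𝓡 n) ∞ M] (g : SmoothRiemannianMetric n M)
    (X Y : ∀ x : M, Submodule ℝ (TangentSpace (𝓡 n) x))
    (hXY : IsOrthogonalSplitting g r s X Y) (hY : EverywhereNonInvolutive Y)
    (K : Set M) (hK : IsCompact K) :
    ∃ f₀ : ℝ, 0 < f₀ ∧ ∀ f : ℝ, f₀ ≤ f →
      ∃ g' : SmoothRiemannianMetric n M, IsCollapsedMetric g X Y f g' ∧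
        ∀ p ∈ K, scalarCurvature g' p < 0 := by
  -- Having a uniform threshold passes to subsets and finite unions and holds near each point, so
  -- compact induction applies.
  have main : ∃ f₀ : ℝ, ∀ f, f₀ ≤ f → 1 ≤ f → ∀ g' : SmoothRiemannianMetric n M,
      IsCollapsedMetric g X Y f g' → ∀ p ∈ K, scalarCurvature g' p < 0 := by
    refine hK.induction_on ⟨0, fun _ _ _ _ _ p hp => hp.elim⟩ ?_ ?_ ?_
    · rintro S T hST ⟨f₀, h⟩
      exact ⟨f₀, fun f hf hf1 g' hg' p hp => h f hf hf1 g' hg' p (hST hp)⟩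
    · rintro S T ⟨f₁, h₁⟩ ⟨f₂, h₂⟩
      refine ⟨max f₁ f₂, fun f hf hf1 g' hg' p hp => ?_⟩
      rcases hp with hp | hp
      · exact h₁ f ((le_max_left _ _).trans hf) hf1 g' hg' p hp
      · exact h₂ f ((le_max_right _ _).trans hf) hf1 g' hg' p hp
    · intro x _
      obtain ⟨t, ht, f₀, h⟩ := exists_nhds_scalarCurvature_neg hXY hY x
      exact ⟨t, mem_nhdsWithin_of_mem_nhds ht, f₀, h⟩
  obtain ⟨f₀, h⟩ := main
  -- The 1 provides the hypothesis 1 ≤ f, used both for the existence of the metric and for the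
  -- estimate.
  refine ⟨max f₀ 1, by positivity, fun f hf => ?_⟩
  have hf1 : 1 ≤ f := (le_max_right _ _).trans hf
  obtain ⟨g', hg'⟩ := exists_isCollapsedMetric hXY hf1
  exact ⟨g', hg', h f ((le_max_left _ _).trans hf) hf1 g' hg'⟩
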